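/- Let $n\ge 1$ and $k\ge 1$ be integers and let $\Bbbk=\mathbb{C}\{\!\{t\}\!\}=\bigcup_{m\ge 1}\mathbb{C}((t^{1/m}))$ be the field of Puiseux series in $t$. Let $e_1,\dots,e_k$ be the elementary symmetric polynomials in $x_1,\dots,x_k$ (with $e_0=1$ and $e_r=0$ for $r>k$), so that $\Bbbk[e_1,\dots,e_k]=\Bbbk[x_1,\dots,x_k]^{\mathfrak{S}_k}$ is a polynomial ring in $e_1,\dots,e_k$. Put $E(u)=\sum_{r\ge 0}e_ru^r$ and define $g_r(t)\in\Bbbk[e_1,\dots,e_k]$ by $$\sum_{r\ge 0}g_r(t)u^r=\frac{E(-tu)}{E(-u)}=\prod_{i=1}^k\frac{1-tx_iu}{1-x_iu},$$ and let $g_r(t^{-1})$ be obtained by replacing $t$ with $t^{-1}$. Set $$\tilde g_n=g_n(t)-(1-t^k),\qquad \tilde g_{n+r}=g_{n+r}(t)+t^kg_r(t^{-1})\quad(1\le r\le k-1),$$ and let $\boldsymbol{I}_{k,n}=\langle\tilde g_n,\dots,\tilde g_{n+k-1}\rangle\subset\Bbbk[e_1,\dots,e_k]$ and $\Bbbk[\boldsymbol{V}_{k,n}]:=\Bbbk[e_1,\dots,e_k]/\boldsymbol{I}_{k,n}$.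 Let $$\mathcal{A}^+_{k,n}=\{\lambda\in\mathbb{Z}^k: n\ge\lambda_1\ge\cdots\ge\lambda_k\ge 1\},\qquad \tilde{\mathcal{A}}^+_{k,n}=\{\lambda\in\mathbb{Z}^k: n>\lambda_1\ge\cdots\ge\lambda_k\ge 0\}.$$ For a partition $\lambda=(\lambda_1\ge\cdots\ge\lambda_k\ge 0)$ let $P_\lambda$ be the Hall--Littlewood polynomial determined by $$P_\lambda\prod_{i=0}^{\lambda_1}(t)_{m_i(\lambda)}=(1-t)^k\sum_{w\in\mathfrak{S}_k}w\Big(x_1^{\lambda_1}\cdots x_k^{\lambda_k}\prod_{i<j}\frac{x_i-tx_j}{x_i-x_j}\Big),$$ where $(t)_m=\prod_{j=1}^m(1-t^j)$ and $m_i(\lambda)$ is the number of indices $j\in\{1,\dots,k\}$ with $\lambda_j=i$. Then the $\Bbbk$-vector space $\Bbbk[\boldsymbol{V}_{k,n}]$ is finite-dimensional, of dimension $|\mathcal{A}^+_{k,n}|=\binom{n+k-1}{k}$, and the classes of the Hall--Littlewood polynomials $P_{\tilde\lambda}$, $\tilde\lambda\in\tilde{\mathcal{A}}^+_{k,n}$,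 form a basis of it. -/

import Mathlib

open MvPolynomial

noncomputable section

/-! ### The field of Puiseux series -/

/-- The field `ℂ{{t}} = ⋃_{m ≥ 1} ℂ((t^{1/m}))` of formal Puiseux series, realised inside the field
of Hahn series with rational exponents: those series all of whose exponents lie in `(1/m)ℤ` for
some integer `m ≥ 1` (their supports are then automatically bounded below). -/
def puiseuxSubfield : Subfield (HahnSeries ℚ ℂ) where
  carrier := {f | ∃ m : ℕ, 0 < m ∧ ∀ q ∈ f.support, ∃ l : ℤ, q = (l : ℚ) / (m : ℚ)}
  mul_mem' := by
    rintro f g ⟨m, hm, hf⟩ ⟨m', hm', hg⟩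
    refine ⟨m * m', Nat.mul_pos hm hm', fun q hq => ?_⟩
    obtain ⟨a, ha, b, hb, rfl⟩ := Set.mem_add.1 (HahnSeries.support_mul_subset hq)
    obtain ⟨l, rfl⟩ := hf a ha
    obtain ⟨l', rfl⟩ := hg b hb
    refine ⟨l * m' + l' * m, ?_⟩
    push_cast
    field_simp
  one_mem' := by
    refine ⟨1, one_pos, fun q hq => ⟨0, ?_⟩⟩
    rw [HahnSeries.support_one] at hq
    simpa using hq
  add_mem' := by
    rintro f g ⟨m, hm, hf⟩ ⟨m', hm', hg⟩
    refine ⟨m * m', Nat.mul_pos hm hm', fun q hq => ?_⟩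
    rcases HahnSeries.support_add_subset f g hq with h | h
    · obtain ⟨l, rfl⟩ := hf q h
      refine ⟨l * m', ?_⟩
      push_cast
      field_simp
    · obtain ⟨l, rfl⟩ := hg q h
      refine ⟨l * m, ?_⟩
      push_cast
      field_simp
  zero_mem' := ⟨1, one_pos, fun q hq => by simp at hq⟩
  neg_mem' := by
    rintro f ⟨m, hm, hf⟩
    exact ⟨m, hm, fun q hq => hf q (by simpa using hq)⟩
  inv_mem' := by
    rintro f ⟨m, hm, hf⟩
    have hm0 : (0 : ℚ) < (m : ℚ) := by exact_mod_cast hm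
    let φ : ℤ →+ ℚ :=
      { toFun := fun l => (l : ℚ) / (m : ℚ)
        map_zero' := by simp
        map_add' := fun a b => by push_cast; ring }
    have hle : ∀ a b : ℤ, φ a ≤ φ b ↔ a ≤ b := fun a b => by
      change (a : ℚ) / (m : ℚ) ≤ (b : ℚ) / (m : ℚ) ↔ _
      rw [div_le_div_iff_of_pos_right hm0]
      exact_mod_cast Iff.rfl
    have hinj : Function.Injective φ := fun a b h =>
      le_antisymm ((hle a b).1 h.le) ((hle b a).1 h.ge)
    let Φ : HahnSeries ℤ ℂ →+* HahnSeries ℚ ℂ := HahnSeries.embDomainRingHom φ hinj hle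
    let e : ℤ ↪o ℚ := ⟨⟨φ, hinj⟩, hle _ _⟩
    let g : HahnSeries ℤ ℂ :=
      { coeff := fun l => f.coeff (φ l)
        isPWO_support' := by
          rw [Set.isPWO_iff_isWF]
          refine Set.isWF_iff_no_descending_seq.2 fun s hs hmem => ?_
          refine Set.isWF_iff_no_descending_seq.1 f.isWF_support (fun i => φ (s i)) ?_ ?_
          · intro i j hij
            exact lt_of_le_of_ne ((hle _ _).2 (hs hij).le) (fun h => (hs hij).ne (hinj h))
          · exact fun i => hmem i }
    have hg : Φ g = f := by
      ext q
      by_cases hq : ∃ l : ℤ, q = φ l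
      · obtain ⟨l, rfl⟩ := hq
        exact HahnSeries.embDomain_coeff (f := e) (x := g) (a := l)
      · have h1 : f.coeff q = 0 := by
          by_contra h
          exact hq (hf q h)
        rw [h1]
        refine HahnSeries.embDomain_of_notMem_range (f := e) (x := g) ?_
        rintro ⟨l, rfl⟩
        exact hq ⟨l, rfl⟩
    refine ⟨m, hm, fun q hq => ?_⟩
    rw [← hg, ← map_inv₀] at hq
    obtain ⟨l, -, rfl⟩ := HahnSeries.support_embDomain_subset (f := e) (x := g⁻¹) hq
    exact ⟨l, rfl⟩

/-- The field `𝕜` of Puiseux series in the indeterminate `t` with complex coefficients. -/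
abbrev PuiseuxField : Type := puiseuxSubfield

/-- The indeterminate `t` of the field of Puiseux series. -/
def puiseuxT : PuiseuxField :=
  ⟨HahnSeries.single (1 : ℚ) (1 : ℂ), 1, one_pos, fun q hq => ⟨1, by
    simpa using HahnSeries.support_single_subset hq⟩⟩

section General

variable {K : Type*} [Field K]

/-! ### The deformed relations in `K[e₁, …, e_k]`

The polynomial ring `K[e₁, …, e_k]` is `MvPolynomial (Fin k) K`; the variable `X i` is `e_{i+1}`. -/

/-- The generator `e_r` of `K[e₁, …, e_k]`, with `e₀ = 1` and `e_r = 0` for `r > k`. -/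
def eVar (K : Type*) [Field K] (k : ℕ) : ℕ → MvPolynomial (Fin k) K
  | 0 => 1
  | r + 1 => if h : r < k then X ⟨r, h⟩ else 0

/-- The generating function `E(c u) = ∑_r e_r c^r u^r`, a power series in `u`. -/
def eGen (k : ℕ) (c : K) : PowerSeries (MvPolynomial (Fin k) K) :=
  PowerSeries.mk fun r => C (c ^ r) * eVar K k r

/-- `g_r(t) = Q_{(r)}(t)` as a polynomial in `e₁, …, e_k`: the coefficient of `u^r` in
`G(u) = ∏ᵢ (1 - t xᵢ u) / (1 - xᵢ u) = E(-t u) / E(-u)`. The series `E(-u)` has constant term `1`,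
and `invOfUnit _ 1` is its inverse. -/
def gPoly (k : ℕ) (t : K) (r : ℕ) : MvPolynomial (Fin k) K :=
  PowerSeries.coeff r (eGen k (-t) * PowerSeries.invOfUnit (eGen k (-1 : K)) 1)

/-- The deformed relation `g̃_{n+r}` (with `z = 1`) for `0 ≤ r ≤ k - 1`:
`g̃_n = g_n(t) - (1 - t^k)` and `g̃_{n+r} = g_{n+r}(t) + t^k g_r(t⁻¹)` for `r = 1, …, k - 1`. -/
def gTilde (n k : ℕ) (t : K) (r : ℕ) : MvPolynomial (Fin k) K :=
  if r = 0 then gPoly k t n - C (1 - t ^ k)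
  else gPoly k t (n + r) + C (t ^ k) * gPoly k t⁻¹ r

/-- The ideal `I_{k,n} = ⟨g̃_n, …, g̃_{n+k-1}⟩` of `K[e₁, …, e_k]`. -/
def betheIdeal (n k : ℕ) (t : K) : Ideal (MvPolynomial (Fin k) K) :=
  Ideal.span {p | ∃ r < k, p = gTilde n k t r}

/-- The coordinate ring `K[e₁, …, e_k] / I_{k,n}`. -/
abbrev CoordRing (n k : ℕ) (t : K) : Type _ := MvPolynomial (Fin k) K ⧸ betheIdeal n k t

/-! ### Hall–Littlewood polynomials in `k` variables -/

/-- The symmetrised rational function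
`R_μ(x₁, …, x_k; t) = ∑_{w ∈ S_k} w (x^μ ∏_{i<j} (xᵢ - t xⱼ) / (xᵢ - xⱼ))`. -/
def hlRFrac (k : ℕ) (t : K) (μ : Fin k → ℕ) : FractionRing (MvPolynomial (Fin k) K) :=
  let x : Fin k → FractionRing (MvPolynomial (Fin k) K) := fun i =>
    algebraMap (MvPolynomial (Fin k) K) _ (X i)
  let c : FractionRing (MvPolynomial (Fin k) K) :=
    algebraMap (MvPolynomial (Fin k) K) _ (C t)
  ∑ w : Equiv.Perm (Fin k), (∏ i, x (w i) ^ μ i) *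
    ∏ i, ∏ j ∈ Finset.Ioi i, (x (w i) - c * x (w j)) / (x (w i) - x (w j))


/-- The substitution `x_j ↦ x_i`, all other variables being fixed. -/
def idVar {k : ℕ} (i j : Fin k) : MvPolynomial (Fin k) K →ₐ[K] MvPolynomial (Fin k) K :=
  aeval fun l => X (if l = j then i else l)

lemma X_sub_X_dvd_sub_idVar {k : ℕ} (i j : Fin k) (f : MvPolynomial (Fin k) K) :
    (X i - X j : MvPolynomial (Fin k) K) ∣ f - idVar i j f := by
  induction f using MvPolynomial.induction_on with
  | C a => simp [idVar, MvPolynomial.algebraMap_eq]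
  | add p q hp hq =>
    rw [map_add, add_sub_add_comm]
    exact dvd_add hp hq
  | mul_X p l hp =>
    rw [map_mul]
    have hX : (X i - X j : MvPolynomial (Fin k) K) ∣ X l - idVar i j (X l) := by
      rw [idVar, aeval_X]
      split_ifs with h
      · subst h
        exact ⟨-1, by ring⟩
      · simp
    have : p * X l - idVar i j p * idVar i j (X l)
        = (p - idVar i j p) * X l + idVar i j p * (X l - idVar i j (X l)) := by ring
    rw [this]
    exact dvd_add (hp.mul_right _) (hX.mul_left _)

lemma X_sub_X_dvd_iff {k : ℕ} {i j : Fin k} (hij : i < j) (f : MvPolynomial (Fin k) K) :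
    (X i - X j : MvPolynomial (Fin k) K) ∣ f ↔ idVar i j f = 0 := by
  constructor
  · rintro ⟨q, rfl⟩
    simp [idVar, hij.ne]
  · intro h
    simpa [h] using X_sub_X_dvd_sub_idVar i j f

lemma X_sub_X_prime {k : ℕ} {i j : Fin k} (hij : i < j) :
    Prime (X i - X j : MvPolynomial (Fin k) K) := by
  refine ⟨?_, ?_, ?_⟩
  · rw [sub_ne_zero]
    exact fun h => hij.ne (X_injective h)
  · intro h
    have h1 := (X_sub_X_dvd_iff hij (1 : MvPolynomial (Fin k) K)).1 h.dvd
    simp at h1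
  · intro a b hab
    rw [X_sub_X_dvd_iff hij, map_mul, mul_eq_zero] at hab
    rwa [X_sub_X_dvd_iff hij, X_sub_X_dvd_iff hij]

lemma X_sub_X_not_dvd {k : ℕ} {i j a b : Fin k} (hij : i < j) (hab : a < b)
    (hne : (i, j) ≠ (a, b)) :
    ¬ ((X i - X j : MvPolynomial (Fin k) K) ∣ X a - X b) := by
  rw [X_sub_X_dvd_iff hij, map_sub, idVar, aeval_X, aeval_X, sub_eq_zero]
  intro h
  have h2 := X_injective h
  apply hne
  split_ifs at h2 <;> simp_all [Prod.ext_iff]; omega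

/-- The Vandermonde product `∏_{i<j} (xᵢ - xⱼ)`. -/
def vdm (K : Type*) [Field K] (k : ℕ) : MvPolynomial (Fin k) K :=
  ∏ i, ∏ j ∈ Finset.Ioi i, (X i - X j)

lemma vdm_ne_zero (k : ℕ) : vdm K k ≠ 0 := by
  refine Finset.prod_ne_zero_iff.2 fun i _ => Finset.prod_ne_zero_iff.2 fun j hj => ?_
  exact (X_sub_X_prime (Finset.mem_Ioi.1 hj)).ne_zero

lemma rename_vdm {k : ℕ} (w : Equiv.Perm (Fin k)) :
    rename w (vdm K k) = ((Equiv.Perm.sign w : ℤ) : MvPolynomial (Fin k) K) * vdm K k := by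
  have := Equiv.Perm.prod_Ioi_comp_eq_sign_mul_prod w
    (f := fun i j => (X i - X j : MvPolynomial (Fin k) K)) (fun i j => by ring)
  simpa [vdm, map_prod] using this

/-- The antisymmetrisation `∑_w sgn(w) w(f)`. -/
def antisym {k : ℕ} (f : MvPolynomial (Fin k) K) : MvPolynomial (Fin k) K :=
  ∑ w : Equiv.Perm (Fin k), ((Equiv.Perm.sign w : ℤ) : MvPolynomial (Fin k) K) * rename w f

lemma rename_antisym {k : ℕ} (f : MvPolynomial (Fin k) K) (v : Equiv.Perm (Fin k)) :
    rename v (antisym f) = ((Equiv.Perm.sign v : ℤ) : MvPolynomial (Fin k) K) * antisym f := by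
  rw [antisym, map_sum, Finset.mul_sum]
  refine Fintype.sum_equiv (Equiv.mulLeft v) _ _ fun w => ?_
  rw [map_mul, map_intCast, rename_rename, ← mul_assoc]
  congr 1
  have hv : (((Equiv.Perm.sign v : ℤ) * (Equiv.Perm.sign v : ℤ) : ℤ) :
      MvPolynomial (Fin k) K) = 1 := by
    rw [← Units.val_mul, Int.units_mul_self]
    simp
  rw [Equiv.coe_mulLeft, map_mul, Units.val_mul, Int.cast_mul, ← mul_assoc, ← Int.cast_mul, hv,
    one_mul]

lemma X_sub_X_dvd_antisym {k : ℕ} {i j : Fin k} (hij : i < j) (f : MvPolynomial (Fin k) K) :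
    (X i - X j : MvPolynomial (Fin k) K) ∣ antisym f := by
  rw [X_sub_X_dvd_iff hij, antisym, map_sum]
  have hs : ∀ p : MvPolynomial (Fin k) K,
      idVar i j (rename (Equiv.swap i j) p) = idVar i j p := by
    intro p
    rw [idVar, aeval_rename]
    congr 2
    funext l
    simp only [Function.comp_apply]
    congr 1
    by_cases h1 : l = i
    · subst h1; simp [hij.ne]
    · by_cases h2 : l = j
      · subst h2; simp [hij.ne]
      · rw [Equiv.swap_apply_of_ne_of_ne h1 h2]
  refine Finset.sum_involution (fun w _ => Equiv.swap i j * w) ?_ ?_ ?_ ?_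
  · intro w _
    rw [map_mul, map_mul, Equiv.Perm.coe_mul, ← rename_rename, hs, map_intCast, map_intCast,
      map_mul, Equiv.Perm.sign_swap hij.ne]
    simp
  · intro w _ _ h
    exact hij.ne (Equiv.swap_eq_one_iff.1 (mul_eq_right.1 h))
  · intro w _
    exact Finset.mem_univ _
  · intro w _
    simp [← mul_assoc]

lemma vdm_dvd_antisym {k : ℕ} (f : MvPolynomial (Fin k) K) : vdm K k ∣ antisym f := by
  rw [vdm, Finset.prod_sigma']
  refine Finset.prod_dvd_of_isRelPrime ?_ ?_
  · rintro ⟨i, j⟩ h ⟨a, b⟩ h' hne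
    have hij : i < j := by simpa using h
    have hab : a < b := by simpa using h'
    refine (X_sub_X_prime hij).irreducible.isRelPrime_iff_not_dvd.2
      (X_sub_X_not_dvd hij hab fun he => hne ?_)
    simp only [Prod.mk.injEq] at he
    obtain ⟨rfl, rfl⟩ := he
    rfl
  · rintro ⟨i, j⟩ h
    exact X_sub_X_dvd_antisym (by simpa using h) f

/-- `R_μ` is a symmetric polynomial. -/
lemma exists_hlR (k : ℕ) (t : K) (μ : Fin k → ℕ) :
    ∃ p : symmetricSubalgebra (Fin k) K,
      algebraMap (MvPolynomial (Fin k) K) (FractionRing (MvPolynomial (Fin k) K)) p.1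
        = hlRFrac k t μ := by
  obtain ⟨f, hf⟩ : ∃ f : MvPolynomial (Fin k) K,
    f = (∏ i, X i ^ μ i) * ∏ i, ∏ j ∈ Finset.Ioi i, (X i - C t * X j) := ⟨_, rfl⟩
  obtain ⟨p, hp⟩ := vdm_dvd_antisym f
  have hsq : ∀ w : Equiv.Perm (Fin k), (((Equiv.Perm.sign w : ℤ)) : MvPolynomial (Fin k) K) *
      ((Equiv.Perm.sign w : ℤ) : MvPolynomial (Fin k) K) = 1 := by
    intro w
    rw [← Int.cast_mul, ← Units.val_mul, Int.units_mul_self]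
    simp
  have hsym : p.IsSymmetric := by
    intro w
    have h := rename_antisym f w
    rw [hp, map_mul, rename_vdm, mul_assoc] at h
    have h2 := congrArg (((Equiv.Perm.sign w : ℤ) : MvPolynomial (Fin k) K) * ·) h
    simp only [← mul_assoc, hsq, one_mul] at h2
    exact mul_left_cancel₀ (vdm_ne_zero k) h2
  refine ⟨⟨p, hsym⟩, ?_⟩
  set a := algebraMap (MvPolynomial (Fin k) K) (FractionRing (MvPolynomial (Fin k) K)) with ha
  have hv : a (vdm K k) ≠ 0 := by
    rw [ha, Ne, IsFractionRing.to_map_eq_zero_iff]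
    exact vdm_ne_zero k
  have hterm : ∀ w : Equiv.Perm (Fin k),
      (∏ i, a (X (w i)) ^ μ i) * ∏ i, ∏ j ∈ Finset.Ioi i,
        (a (X (w i)) - a (C t) * a (X (w j))) / (a (X (w i)) - a (X (w j)))
      = a (((Equiv.Perm.sign w : ℤ) : MvPolynomial (Fin k) K) * rename w f) / a (vdm K k) := by
    intro w
    have hd : ∏ i, ∏ j ∈ Finset.Ioi i, (a (X (w i)) - a (X (w j)))
        = a (((Equiv.Perm.sign w : ℤ) : MvPolynomial (Fin k) K)) * a (vdm K k) := by
      rw [← map_mul, ← rename_vdm]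
      simp [vdm, map_prod]
    have hn : (∏ i, a (X (w i)) ^ μ i) * ∏ i, ∏ j ∈ Finset.Ioi i,
        (a (X (w i)) - a (C t) * a (X (w j))) = a (rename w f) := by
      simp [hf, map_prod]
    have hs := congrArg a (hsq w)
    rw [map_mul, map_one] at hs
    have hs0 : a (((Equiv.Perm.sign w : ℤ) : MvPolynomial (Fin k) K)) ≠ 0 :=
      left_ne_zero_of_mul_eq_one hs
    simp_rw [Finset.prod_div_distrib]
    rw [hd, ← mul_div_assoc, hn, map_mul, div_eq_div_iff (mul_ne_zero hs0 hv) hv]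
    linear_combination (-(a (rename w f) * a (vdm K k))) * hs
  have : hlRFrac k t μ = a (antisym f) / a (vdm K k) := by
    rw [antisym, map_sum, Finset.sum_div]
    exact Finset.sum_congr rfl fun w _ => hterm w
  rw [this, hp, map_mul, mul_div_cancel_left₀ _ hv]

/-- `R_μ` as an element of the ring of symmetric polynomials in `x₁, …, x_k`: the unique symmetric
polynomial that is equal to `hlRFrac k t μ` in the field of rational functions. -/
def hlR (k : ℕ) (t : K) (μ : Fin k → ℕ) : symmetricSubalgebra (Fin k) K :=
  (exists_hlR k t μ).choose

/-- `(t)_m = (1 - t)(1 - t²) ⋯ (1 - t^m)`. -/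
def tPoch (t : K) (m : ℕ) : K := ∏ j ∈ Finset.range m, (1 - t ^ (j + 1))

/-- The multiplicity `m_i(λ)` of `i` among the `k` parts of `λ` (the part `0` is allowed, so that
`m_0(λ) = k - ℓ(λ)`). -/
def partMult {k : ℕ} (lam : Fin k → ℕ) (i : ℕ) : ℕ := (Finset.univ.filter fun j => lam j = i).card

/-- The Hall–Littlewood polynomial `P_λ(x₁, …, x_k; t)`, normalised by
`(1 - t)^k R_λ = P_λ ∏_{i=0}^{λ₁} (t)_{m_i(λ)}`; here `λ₁` is the largest part of `λ`, and `t` must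
not be a root of unity. -/
def hlP (k : ℕ) (t : K) (lam : Fin k → ℕ) : symmetricSubalgebra (Fin k) K :=
  ((1 - t) ^ k / ∏ i ∈ Finset.range (Finset.univ.sup lam + 1), tPoch t (partMult lam i)) •
    hlR k t lam

/-- `P_λ` as a polynomial in `e₁, …, e_k`, through the fundamental theorem on symmetric polynomials
(`esymmAlgEquiv` sends the variable `X i` to the elementary symmetric polynomial `e_{i+1}(x)`). -/
def hlPe (k : ℕ) (t : K) (lam : Fin k → ℕ) : MvPolynomial (Fin k) K :=
  (esymmAlgEquiv (Fin k) K (Fintype.card_fin k)).symm (hlP k t lam)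

end General

/-! ### The index sets -/

/-- `𝒜⁺_{k,n} = {λ : n ≥ λ₁ ≥ λ₂ ≥ ⋯ ≥ λ_k ≥ 1}`. -/
def alcove (k n : ℕ) : Set (Fin k → ℕ) := {lam | Antitone lam ∧ ∀ i, 1 ≤ lam i ∧ lam i ≤ n}

/-- `𝒜̃⁺_{k,n} = {λ : n > λ₁ ≥ λ₂ ≥ ⋯ ≥ λ_k ≥ 0}`. -/
def redAlcove (k n : ℕ) : Set (Fin k → ℕ) := {lam | Antitone lam ∧ ∀ i, lam i < n}

end

/-! Give `e_r` weight `r` and filter the polynomial ring by weight. The relation `gTilde n k t r`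
has leading part `g_{n+r}`, so the deformation only changes terms of smaller weight. The claim
behind the theorem is that the polynomial ring is free over the subalgebra generated by the `k`
relations, with basis the `R_λ`, `λ` in the box; killing the relations leaves exactly these `R_λ`,
and `P_λ` is a nonzero multiple of `R_λ` because `t` is not a root of unity.

Spanning (`weightFil_le_hlProdSpan`): all `R_λ` with `λ` a partition span, by straightening and
because `R_0` is a nonzero scalar. If `λ₁ ≥ n`, summing first over the variable carrying `λ₁` writes
`R_λ` as a combination of weighted power sums `∑ cᵢ xᵢ^m` with `m ≥ n`. By partial fractions these
are the `g_m`, which lie in the ideal of `g_n, …, g_{n+k-1}`. Replacing each `g_{n+r}` by its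
deformation and inducting on weight finishes the argument.

Independence (`linearIndepOn_hlProd`) is a count: by the Gaussian binomial identity
(`boxSeries_mul_prod`) the products of weight at most `d` are as numerous as the monomials in the
`e_r` of weight at most `d`, so a spanning family of that size is independent. -/

noncomputable section

/-! ### Counting: weighted exponent vectors and partitions in a box. -/

/-- Exponent vectors of weight at most `d`, where the `i`-th entry has weight `w i`. -/
def weightLE {k : ℕ} (w : Fin k → ℕ) (d : ℕ) : Set (Fin k → ℕ) := {α | ∑ i, w i * α i ≤ d}

lemma weightLE_finite {k : ℕ} {w : Fin k → ℕ} (hw : ∀ i, 0 < w i) (d : ℕ) :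
    (weightLE w d).Finite := by
  refine (Set.finite_Iic (fun _ : Fin k => d)).subset fun α hα i => ?_
  calc α i ≤ w i * α i := Nat.le_mul_of_pos_left _ (hw i)
    _ ≤ ∑ i, w i * α i := Finset.single_le_sum (f := fun i => w i * α i) (fun _ _ => Nat.zero_le _)
      (Finset.mem_univ i)
    _ ≤ d := hα

/-- The generating series of the numbers of exponent vectors of weight at most `d`. -/
def countSeries {k : ℕ} (w : Fin k → ℕ) : PowerSeries ℤ :=
  PowerSeries.mk fun d => ((weightLE w d).ncard : ℤ)

/-- Either the first exponent is zero and can be dropped, or it can be lowered by one. -/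
lemma ncard_weightLE_succ {k : ℕ} {w : Fin (k + 1) → ℕ} (hw : ∀ i, 0 < w i) (d : ℕ) :
    (weightLE w d).ncard = (weightLE (fun i => w i.succ) d).ncard +
      if w 0 ≤ d then (weightLE w (d - w 0)).ncard else 0 := by
  have hset : weightLE w d = (Fin.cons 0 '' weightLE (fun i => w i.succ) d) ∪
      (if w 0 ≤ d then (fun α => α + Pi.single 0 1) '' weightLE w (d - w 0) else ∅) := by
    ext α
    have hs : ∑ i, w i * α i = w 0 * α 0 + ∑ i : Fin k, w i.succ * α i.succ := Fin.sum_univ_succ _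
    constructor
    · intro h
      have h : ∑ i, w i * α i ≤ d := h
      by_cases h0 : α 0 = 0
      · left
        refine ⟨fun i => α i.succ, ?_, ?_⟩
        · rw [hs, h0] at h
          change ∑ i : Fin k, w i.succ * α i.succ ≤ d
          omega
        · rw [← h0]; exact Fin.cons_self_tail α
      · right
        obtain ⟨a, ha⟩ := Nat.exists_eq_succ_of_ne_zero h0
        have h1 : w 0 * α 0 = w 0 * a + w 0 := by rw [ha]; rfl
        have : w 0 ≤ d := by omega
        rw [if_pos this]
        refine ⟨Fin.cons a fun i => α i.succ, ?_, ?_⟩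
        · change ∑ i, w i * (Fin.cons a (fun i => α i.succ) : Fin (k + 1) → ℕ) i ≤ d - w 0
          rw [Fin.sum_univ_succ]
          simp only [Fin.cons_zero, Fin.cons_succ]
          omega
        · funext i
          refine Fin.cases ?_ (fun i => ?_) i
          · simp [ha]
          · simp
    · rintro (⟨β, hβ, rfl⟩ | h)
      · change ∑ i, w i * (Fin.cons 0 β : Fin (k + 1) → ℕ) i ≤ d
        rw [Fin.sum_univ_succ]
        simpa [weightLE] using hβ
      · split_ifs at h with h0
        · obtain ⟨β, hβ, rfl⟩ := h
          have hβ : ∑ i, w i * β i ≤ d - w 0 := hβ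
          change ∑ i, w i * (β i + (Pi.single 0 1 : Fin (k + 1) → ℕ) i) ≤ d
          simp only [mul_add, Finset.sum_add_distrib]
          have : ∑ i, w i * (Pi.single 0 1 : Fin (k + 1) → ℕ) i = w 0 := by
            simp [Pi.single_apply]
          omega
        · exact h.elim
  rw [hset, Set.ncard_union_eq ?_ ?_ ?_]
  · congr 1
    · exact Set.ncard_image_of_injective _ (Fin.cons_right_injective _)
    · split_ifs
      · exact Set.ncard_image_of_injective _ (add_left_injective _)
      · simp
  · rw [Set.disjoint_left]
    rintro _ ⟨β, -, rfl⟩ h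
    split_ifs at h
    · obtain ⟨γ, -, hγ⟩ := h
      have := congrFun hγ 0
      simp at this
    · exact h
  · exact (weightLE_finite (fun i => hw i.succ) d).image _
  · split_ifs
    · exact (weightLE_finite hw _).image _
    · exact Set.finite_empty

lemma countSeries_mul_one_sub {k : ℕ} {w : Fin (k + 1) → ℕ} (hw : ∀ i, 0 < w i) :
    countSeries w * (1 - PowerSeries.X ^ w 0) = countSeries fun i => w i.succ := by
  ext d
  rw [mul_sub, mul_one, map_sub, PowerSeries.coeff_mul_X_pow']
  simp only [countSeries, PowerSeries.coeff_mk]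
  rw [ncard_weightLE_succ hw d]
  split_ifs <;> push_cast <;> ring

/-- The right side is `1/(1 - X)` rather than `1` because weights are counted up to `d`, not equal
to `d`. -/
lemma countSeries_mul_prod {k : ℕ} {w : Fin k → ℕ} (hw : ∀ i, 0 < w i) :
    countSeries w * ∏ i, (1 - PowerSeries.X ^ w i) = PowerSeries.mk fun _ => 1 := by
  induction k with
  | zero =>
    ext d
    have : weightLE w d = {default} := by
      ext α
      simp [weightLE, eq_iff_true_of_subsingleton]
    simp [countSeries, this]
  | succ k ih =>
    rw [Fin.prod_univ_succ, ← mul_assoc, countSeries_mul_one_sub hw]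
    exact ih fun i => hw i.succ

lemma redAlcove_finite (k n : ℕ) : (redAlcove k n).Finite :=
  (Set.finite_Iic (fun _ : Fin k => n)).subset fun _ h i => (h.2 i).le

lemma redAlcove_zero_left (n : ℕ) : redAlcove 0 n = {default} := by
  ext α
  simp only [redAlcove, Set.mem_ofPred_eq, Set.mem_singleton_iff, eq_iff_true_of_subsingleton,
    iff_true]
  exact ⟨fun i => i.elim0, fun i => i.elim0⟩

lemma redAlcove_zero_right (k : ℕ) : redAlcove (k + 1) 0 = ∅ := by
  ext α
  simp only [redAlcove, Set.mem_ofPred_eq, Set.mem_empty_iff_false, iff_false]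
  exact fun h => absurd (h.2 0) (by simp)

lemma antitone_cons_iff {k : ℕ} (a : ℕ) (β : Fin k → ℕ) :
    Antitone (Fin.cons a β : Fin (k + 1) → ℕ) ↔ (∀ i, β i ≤ a) ∧ Antitone β := by
  constructor
  · intro h
    refine ⟨fun i => ?_, fun i j hij => ?_⟩
    · simpa using h (Fin.zero_le i.succ)
    · simpa using h (Fin.succ_le_succ_iff.2 hij)
  · rintro ⟨h1, h2⟩ i j hij
    induction i using Fin.cases with
    | zero =>
      induction j using Fin.cases with
      | zero => simp
      | succ j => simpa using h1 j
    | succ i =>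
      induction j using Fin.cases with
      | zero => simp at hij
      | succ j => simpa using h2 (Fin.succ_le_succ_iff.1 hij)

/-- The two pieces are largest part below `n` and largest part equal to `n`; this is the `q`-Pascal
recursion. -/
lemma redAlcove_succ (k n : ℕ) :
    redAlcove (k + 1) (n + 1) = redAlcove (k + 1) n ∪ Fin.cons n '' redAlcove k (n + 1) := by
  ext α
  obtain ⟨a, β, rfl⟩ : ∃ a β, α = Fin.cons a β := ⟨α 0, fun i => α i.succ,
    (Fin.cons_self_tail α).symm⟩
  simp only [redAlcove, Set.mem_union, Set.mem_ofPred_eq, antitone_cons_iff, Set.mem_image,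
    Fin.forall_fin_succ, Fin.cons_zero, Fin.cons_succ, Fin.cons_inj]
  constructor
  · rintro ⟨⟨h1, h2⟩, h3, h4⟩
    by_cases ha : a = n
    · exact Or.inr ⟨β, ⟨h2, h4⟩, ha.symm, rfl⟩
    · exact Or.inl ⟨⟨h1, h2⟩, by omega, fun i => by have := h1 i; omega⟩
  · rintro (⟨⟨h1, h2⟩, h3, h4⟩ | ⟨γ, ⟨h1, h2⟩, rfl, rfl⟩)
    · exact ⟨⟨h1, h2⟩, by omega, fun i => by have := h4 i; omega⟩
    · exact ⟨⟨fun i => by have := h2 i; omega, h1⟩, by omega, h2⟩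

lemma disjoint_redAlcove_cons (k n : ℕ) :
    Disjoint (redAlcove (k + 1) n) (Fin.cons n '' redAlcove k (n + 1)) := by
  rw [Set.disjoint_left]
  rintro _ h ⟨β, -, rfl⟩
  simpa using h.2 0

/-- The generating polynomial `∑ X^{|λ|}` of the partitions in a box. -/
def boxSeries (k n : ℕ) : PowerSeries ℤ :=
  ∑ lam ∈ (redAlcove_finite k n).toFinset, PowerSeries.X ^ (∑ i, lam i)

lemma redAlcove_toFinset_succ (k n : ℕ) :
    (redAlcove_finite (k + 1) (n + 1)).toFinset = (redAlcove_finite (k + 1) n).toFinset.disjUnion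
      ((redAlcove_finite k (n + 1)).toFinset.map ⟨Fin.cons n, Fin.cons_right_injective _⟩) (by
        rw [← Finset.disjoint_coe]
        simpa using disjoint_redAlcove_cons k n) := by
  ext α
  simp [redAlcove_succ]

lemma boxSeries_succ (k n : ℕ) :
    boxSeries (k + 1) (n + 1) = boxSeries (k + 1) n + PowerSeries.X ^ n * boxSeries k (n + 1) := by
  rw [boxSeries, redAlcove_toFinset_succ, Finset.sum_disjUnion, Finset.sum_map, boxSeries,
    boxSeries, Finset.mul_sum]
  congr 1
  refine Finset.sum_congr rfl fun β _ => ?_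
  simp [Fin.sum_univ_succ, pow_add]

/-- The Gaussian binomial formula with denominators cleared. For `n = 0` and `k > 0` the box is
empty, matching the factor `1 - X^0` on the right. -/
lemma boxSeries_mul_prod (k n : ℕ) :
    boxSeries k n * ∏ i : Fin k, (1 - PowerSeries.X ^ ((i : ℕ) + 1)) =
      ∏ i : Fin k, (1 - PowerSeries.X ^ (n + (i : ℕ))) := by
  induction k generalizing n with
  | zero => simp [boxSeries, redAlcove_zero_left]
  | succ k ihk =>
    induction n with
    | zero =>
      rw [Fin.prod_univ_succ (f := fun i : Fin (k + 1) => (1 - PowerSeries.X ^ (0 + (i : ℕ))))]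
      simp [boxSeries, redAlcove_zero_right]
    | succ n ihn =>
      rw [boxSeries_succ, add_mul, ihn, Fin.prod_univ_succ]
      rw [Fin.prod_univ_castSucc (f := fun i : Fin (k + 1) => (1 - PowerSeries.X ^ ((i : ℕ) + 1))),
        Fin.prod_univ_castSucc
          (f := fun i : Fin (k + 1) => (1 - PowerSeries.X ^ (n + 1 + (i : ℕ))))]
      have h := ihk (n + 1)
      simp only [Fin.val_zero, Fin.val_succ, Fin.val_castSucc, Fin.val_last] at h ⊢
      have h2 : ∀ i : Fin k, n + ((i : ℕ) + 1) = n + 1 + i := fun i => by ring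
      simp only [h2]
      have h3 : (PowerSeries.X : PowerSeries ℤ) ^ (n + 1 + k) =
        PowerSeries.X ^ n * PowerSeries.X ^ (k + 1) := by rw [← pow_add]; congr 1; ring
      rw [h3]
      linear_combination (PowerSeries.X ^ n * (1 - PowerSeries.X ^ (k + 1))) * h

lemma ncard_redAlcove (k n : ℕ) (h : 1 ≤ n + k) :
    (redAlcove k n).ncard = (n + k - 1).choose k := by
  induction k generalizing n with
  | zero => simp [redAlcove_zero_left]
  | succ k ihk =>
    induction n with
    | zero => simp [redAlcove_zero_right]
    | succ n ihn =>
      rw [redAlcove_succ, Set.ncard_union_eq (disjoint_redAlcove_cons k n)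
        (redAlcove_finite _ _) ((redAlcove_finite _ _).image _),
        Set.ncard_image_of_injective _ (Fin.cons_right_injective _), ihk _ (by omega),
        ihn (by omega)]
      have e1 : n + (k + 1) - 1 = n + k := by omega
      have e2 : n + 1 + k - 1 = n + k := by omega
      have e3 : n + 1 + (k + 1) - 1 = n + k + 1 := by omega
      rw [e1, e2, e3, Nat.choose_succ_succ, add_comm]

lemma ncard_alcove (k n : ℕ) : (alcove k n).ncard = (redAlcove k n).ncard := by
  have : alcove k n = (fun α => α + 1) '' redAlcove k n := by
    ext α
    constructor
    · rintro ⟨h1, h2⟩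
      refine ⟨fun i => α i - 1, ⟨fun i j hij => Nat.sub_le_sub_right (h1 hij) 1, fun i => ?_⟩, ?_⟩
      · have := h2 i
        change α i - 1 < n
        omega
      · funext i
        exact Nat.sub_add_cancel (h2 i).1
    · rintro ⟨β, ⟨h1, h2⟩, rfl⟩
      exact ⟨fun i j hij => Nat.add_le_add_right (h1 hij) 1, fun i => ⟨Nat.le_add_left _ _, h2 i⟩⟩
  rw [this, Set.ncard_image_of_injective _ (add_left_injective _)]

/-- Pairs of a partition in the box and an exponent vector, of total weight at most `d`. -/
def pairLE (k n : ℕ) (w : Fin k → ℕ) (d : ℕ) : Set ((Fin k → ℕ) × (Fin k → ℕ)) :=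
  {x | x.1 ∈ redAlcove k n ∧ ∑ i, x.1 i + ∑ i, w i * x.2 i ≤ d}

lemma pairLE_finite (k n : ℕ) {w : Fin k → ℕ} (hw : ∀ i, 0 < w i) (d : ℕ) :
    (pairLE k n w d).Finite :=
  ((redAlcove_finite k n).prod (weightLE_finite hw d)).subset fun _ hx =>
    ⟨hx.1, (Nat.le_add_left _ _).trans hx.2⟩

/-- Fibre over the partition `λ`: it uses up weight `|λ|`, which is multiplication by `X^|λ|`. -/
lemma ncard_pairLE (k n : ℕ) {w : Fin k → ℕ} (hw : ∀ i, 0 < w i) (d : ℕ) :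
    ((pairLE k n w d).ncard : ℤ) = PowerSeries.coeff d (boxSeries k n * countSeries w) := by
  classical
  rw [Set.ncard_eq_toFinset_card _ (pairLE_finite k n hw d),
    Finset.card_eq_sum_card_fiberwise (f := Prod.fst) (t := (redAlcove_finite k n).toFinset),
    boxSeries, Finset.sum_mul, map_sum]
  · push_cast
    refine Finset.sum_congr rfl fun lam hlam => ?_
    rw [PowerSeries.coeff_X_pow_mul']
    split_ifs with h
    · rw [countSeries, PowerSeries.coeff_mk,
        Set.ncard_eq_toFinset_card _ (weightLE_finite hw (d - ∑ i, lam i))]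
      congr 1
      refine (Finset.card_bij (fun α _ => (lam, α)) ?_ ?_ ?_).symm
      · intro α hα
        have hα : ∑ i, w i * α i ≤ d - ∑ i, lam i := by simpa [weightLE] using hα
        simp only [Finset.mem_filter, Set.Finite.mem_toFinset] at hlam ⊢
        exact ⟨⟨hlam, by dsimp only; omega⟩, trivial⟩
      · intro α _ β _ h
        exact (Prod.mk.inj h).2
      · rintro ⟨a, b⟩ hab
        simp only [Finset.mem_filter, Set.Finite.mem_toFinset] at hab
        obtain ⟨⟨-, h1⟩, rfl⟩ := hab
        refine ⟨b, ?_, rfl⟩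
        simp only [Set.Finite.mem_toFinset]
        change ∑ i, w i * b i ≤ _
        dsimp only at h1 ⊢
        omega
    · norm_cast
      rw [Finset.card_eq_zero, Finset.filter_eq_empty_iff]
      rintro ⟨a, b⟩ hab rfl
      have := ((pairLE_finite k n hw d).mem_toFinset.1 hab).2
      dsimp only at this h
      omega
  · intro x hx
    have := ((pairLE_finite k n hw d).mem_toFinset.1 hx).1
    simpa using this

/-- Partitions in the box together with products of variables of degrees `n, …, n + k - 1` are as
numerous as products of variables of degrees `1, …, k`. -/
lemma ncard_pairLE_eq (k n : ℕ) (hn : 0 < n) (d : ℕ) :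
    (pairLE k n (fun i => n + (i : ℕ)) d).ncard =
      (weightLE (fun i : Fin k => (i : ℕ) + 1) d).ncard := by
  have h1 := countSeries_mul_prod (w := fun i : Fin k => n + (i : ℕ)) (fun i => by omega)
  have h2 := countSeries_mul_prod (w := fun i : Fin k => (i : ℕ) + 1) (fun i => by omega)
  have h3 := boxSeries_mul_prod k n
  have h4 : boxSeries k n * countSeries (fun i : Fin k => n + (i : ℕ)) =
      countSeries fun i : Fin k => (i : ℕ) + 1 := by
    have hne : ∏ i : Fin k, (1 - PowerSeries.X ^ ((i : ℕ) + 1) : PowerSeries ℤ) ≠ 0 := by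
      refine Finset.prod_ne_zero_iff.2 fun i _ h => ?_
      have := congrArg (PowerSeries.coeff 0) h
      simp at this
    refine mul_right_cancel₀ hne ?_
    rw [h2, ← h1]
    linear_combination (countSeries fun i : Fin k => n + (i : ℕ)) * h3
  have h5 := ncard_pairLE k n (w := fun i : Fin k => n + (i : ℕ)) (fun i => by omega) d
  rw [h4, countSeries, PowerSeries.coeff_mk] at h5
  exact_mod_cast h5

/-! ### Partial fractions: `g_r` as a weighted power sum. -/

section

variable {K L : Type*} [Field K] [Field L] [Algebra K L]

/-- Evaluation of a polynomial in `e₁, …, e_k` at the point with coordinates `y`. -/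
def symmEval {k : ℕ} (y : Fin k → L) : MvPolynomial (Fin k) K →ₐ[K] L :=
  aeval fun i => aeval y (esymm (Fin k) K (i + 1))

lemma symmEval_eq {k : ℕ} (y : Fin k → L) (p : MvPolynomial (Fin k) K) :
    symmEval y p = aeval y (esymmAlgEquiv (Fin k) K (Fintype.card_fin k) p).1 := by
  have : symmEval y = (aeval y).comp ((symmetricSubalgebra (Fin k) K).val.comp
      (esymmAlgEquiv (Fin k) K (Fintype.card_fin k)).toAlgHom) := by
    refine algHom_ext fun i => ?_
    have h := esymmAlgEquiv_symm_apply (R := K) (Fintype.card_fin k) i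
    rw [AlgEquiv.symm_apply_eq] at h
    simp only [symmEval, aeval_X, AlgHom.comp_apply, AlgEquiv.coe_toAlgHom]
    rw [← h]
    rfl
  rw [this]
  rfl

lemma symmEval_eVar {k : ℕ} (y : Fin k → L) (r : ℕ) :
    symmEval y (eVar K k r) = aeval y (esymm (Fin k) K r) := by
  cases r with
  | zero => simp [eVar]
  | succ r =>
    rw [eVar]
    split_ifs with h
    · simp [symmEval]
    · rw [map_zero, esymm, Finset.powersetCard_eq_empty.2 (by simpa using h), Finset.sum_empty,
        map_zero]

lemma coeff_prod_one_add {k : ℕ} (y : Fin k → L) (c : L) (r : ℕ) :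
    PowerSeries.coeff r (∏ i, (1 + PowerSeries.C (c * y i) * PowerSeries.X)) =
      c ^ r * aeval y (esymm (Fin k) K r) := by
  classical
  rw [Finset.prod_one_add, map_sum, esymm, map_sum, Finset.mul_sum]
  have h : ∀ s : Finset (Fin k), PowerSeries.coeff r
      (∏ i ∈ s, PowerSeries.C (c * y i) * PowerSeries.X) =
      if s.card = r then c ^ r * ∏ i ∈ s, y i else 0 := by
    intro s
    rw [Finset.prod_mul_distrib, Finset.prod_const, ← map_prod, PowerSeries.coeff_C_mul,
      PowerSeries.coeff_X_pow, Finset.prod_mul_distrib, Finset.prod_const]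
    by_cases hs : s.card = r
    · simp [hs]
    · simp [hs, Ne.symm hs]
  rw [Finset.sum_congr rfl fun s _ => h s, ← Finset.sum_filter,
    Finset.powersetCard_eq_filter]
  refine Finset.sum_congr rfl fun s _ => ?_
  simp [map_prod]

lemma map_eGen {k : ℕ} (y : Fin k → L) (c : K) :
    PowerSeries.map (symmEval y : MvPolynomial (Fin k) K →ₐ[K] L).toRingHom (eGen k c) =
      ∏ i, (1 + PowerSeries.C (algebraMap K L c * y i) * PowerSeries.X) := by
  ext r
  rw [coeff_prod_one_add (K := K), PowerSeries.coeff_map, eGen, PowerSeries.coeff_mk]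
  simp [symmEval_eVar, ← algebraMap_eq]

lemma eGen_mul_invOfUnit (k : ℕ) (c : K) :
    eGen k c * PowerSeries.invOfUnit (eGen k c) 1 = 1 :=
  PowerSeries.mul_invOfUnit _ _ (by simp [eGen, eVar])

lemma gGen_mul_eGen (k : ℕ) (t : K) :
    PowerSeries.mk (gPoly k t) * eGen k (-1) = eGen k (-t) := by
  have : PowerSeries.mk (gPoly k t) =
      eGen k (-t) * PowerSeries.invOfUnit (eGen k (-1 : K)) 1 := by
    ext r
    simp [gPoly]
  rw [this, mul_assoc, mul_comm (PowerSeries.invOfUnit _ _), eGen_mul_invOfUnit, mul_one]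

/-- The residue of `∏ᵢ (1 - t yᵢ u) / (1 - yᵢ u)` at `u = yᵢ⁻¹`. -/
def hlResidue {k : ℕ} (t : L) (y : Fin k → L) (i : Fin k) : L :=
  (1 - t) * ∏ j ∈ Finset.univ.erase i, (y i - t * y j) / (y i - y j)

lemma natDegree_one_sub_C_mul_X_le (a : L) :
    (1 - Polynomial.C a * Polynomial.X).natDegree ≤ 1 := by
  compute_degree

/-- The difference of the two sides has degree less than `k`, since both have the same coefficient
at `u^k`, and it vanishes at the `k` distinct points `yᵢ⁻¹`, where only the `i`-th summand survives.
The term `t^k` is the value of the quotient at `u = ∞`. -/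
lemma prod_one_sub_partial_fractions {k : ℕ} (t : L) {y : Fin k → L} (hy : Function.Injective y)
    (hy0 : ∀ i, y i ≠ 0) :
    ∏ i, (1 - Polynomial.C (t * y i) * Polynomial.X) =
      Polynomial.C (t ^ k) * ∏ i, (1 - Polynomial.C (y i) * Polynomial.X) +
      ∑ i, Polynomial.C (hlResidue t y i) *
        ∏ j ∈ Finset.univ.erase i, (1 - Polynomial.C (y j) * Polynomial.X) := by
  have hdeg : ∀ (s : Finset (Fin k)) (z : Fin k → L),
      (∏ i ∈ s, (1 - Polynomial.C (z i) * Polynomial.X)).natDegree ≤ s.card := by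
    intro s z
    refine (Polynomial.natDegree_prod_le _ _).trans ?_
    refine (Finset.sum_le_card_nsmul _ _ 1 fun i _ => natDegree_one_sub_C_mul_X_le _).trans ?_
    simp
  have hcoeff : ∀ z : Fin k → L,
      (∏ i, (1 - Polynomial.C (z i) * Polynomial.X)).coeff k = ∏ i, (-z i) := by
    intro z
    have := Polynomial.coeff_prod_of_natDegree_le (s := Finset.univ)
      (fun i => 1 - Polynomial.C (z i) * Polynomial.X) 1 fun i _ => natDegree_one_sub_C_mul_X_le _
    rw [Finset.card_univ, Fintype.card_fin, mul_one] at this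
    rw [this]
    simp [Polynomial.coeff_one]
  rw [← sub_eq_zero]
  refine Polynomial.eq_zero_of_degree_lt_of_eval_index_eq_zero (v := fun i => (y i)⁻¹)
    (s := Finset.univ) (fun i _ j _ h => hy (inv_injective h)) ?_ ?_
  · rw [Finset.card_univ, Fintype.card_fin, Polynomial.degree_lt_iff_coeff_zero]
    have hsum : ∀ m, k ≤ m → ∀ i, (∏ j ∈ Finset.univ.erase i,
        (1 - Polynomial.C (y j) * Polynomial.X)).coeff m = 0 := by
      intro m hm i
      refine Polynomial.coeff_eq_zero_of_natDegree_lt ((hdeg _ _).trans_lt ?_)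
      rw [Finset.card_erase_of_mem (Finset.mem_univ i), Finset.card_univ, Fintype.card_fin]
      have := i.pos
      omega
    intro m hm
    rw [Polynomial.coeff_sub, Polynomial.coeff_add, Polynomial.finsetSum_coeff,
      Polynomial.coeff_C_mul]
    simp only [Polynomial.coeff_C_mul, hsum m hm, mul_zero, Finset.sum_const_zero, add_zero]
    rcases hm.eq_or_lt with rfl | hm
    · rw [hcoeff, hcoeff]
      simp [← mul_neg, Finset.prod_mul_distrib]
    · rw [Polynomial.coeff_eq_zero_of_natDegree_lt ((hdeg _ _).trans_lt (by simpa using hm)),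
        Polynomial.coeff_eq_zero_of_natDegree_lt ((hdeg _ _).trans_lt (by simpa using hm))]
      simp
  · intro i _
    have hz : ∏ j, (1 - y j * (y i)⁻¹) = 0 :=
      Finset.prod_eq_zero (Finset.mem_univ i) (by rw [mul_inv_cancel₀ (hy0 i), sub_self])
    have hz' : ∀ l ∈ Finset.univ, l ≠ i → hlResidue t y l *
        ∏ j ∈ Finset.univ.erase l, (1 - y j * (y i)⁻¹) = 0 := by
      intro l _ hl
      rw [Finset.prod_eq_zero (Finset.mem_erase.2 ⟨hl.symm, Finset.mem_univ i⟩)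
        (by rw [mul_inv_cancel₀ (hy0 i), sub_self]), mul_zero]
    simp only [Polynomial.eval_sub, Polynomial.eval_add, Polynomial.eval_mul,
      Polynomial.eval_C, Polynomial.eval_prod, Polynomial.eval_finsetSum, Polynomial.eval_one,
      Polynomial.eval_X]
    rw [hz, Finset.sum_eq_single i hz' (by simp), mul_zero, zero_add, sub_eq_zero,
      ← Finset.mul_prod_erase _ _ (Finset.mem_univ i), hlResidue, mul_assoc t,
      mul_inv_cancel₀ (hy0 i), mul_one, mul_assoc, ← Finset.prod_mul_distrib]
    congr 1
    refine Finset.prod_congr rfl fun j hj => ?_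
    have h1 : y i - y j ≠ 0 := sub_ne_zero.2 fun h => (Finset.mem_erase.1 hj).1 (hy h).symm
    have h2 := hy0 i
    field_simp

/-- `g_r` for `r ≥ 1`, and `1 - t^k` for `r = 0`: the power sum `∑ᵢ cᵢ yᵢ^r` weighted by the
residues. -/
def gSum (k : ℕ) (t : K) (r : ℕ) : MvPolynomial (Fin k) K :=
  if r = 0 then C (1 - t ^ k) else gPoly k t r

/-- Each partial fraction expands as a geometric series. The constant `t^k` affects only `r = 0`,
where `g_0 = 1`; hence the value `1 - t^k` there. -/
lemma symmEval_gSum {k : ℕ} (t : K) {y : Fin k → L} (hy : Function.Injective y)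
    (hy0 : ∀ i, y i ≠ 0) (r : ℕ) :
    symmEval y (gSum k t r) = ∑ i, hlResidue (algebraMap K L t) y i * y i ^ r := by
  set τ := algebraMap K L t
  have h1 := congrArg (PowerSeries.map (symmEval y : MvPolynomial (Fin k) K →ₐ[K] L).toRingHom)
    (gGen_mul_eGen k t)
  rw [map_mul, map_eGen, map_eGen] at h1
  have h2 := congrArg (fun p : Polynomial L => (p : PowerSeries L))
    (prod_one_sub_partial_fractions τ hy hy0)
  have hgeo : ∀ i, PowerSeries.mk (fun r => y i ^ r) *
      (1 - PowerSeries.C (y i) * PowerSeries.X) = 1 := by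
    intro i
    ext r
    cases r with
    | zero => simp [mul_sub]
    | succ r =>
      rw [mul_sub, mul_one, map_sub, ← mul_assoc, PowerSeries.coeff_succ_mul_X,
        PowerSeries.coeff_mul_C]
      simp [PowerSeries.coeff_one, pow_succ]
  have hprod : (∏ i, (1 - PowerSeries.C (y i) * PowerSeries.X)) ≠ 0 :=
    Finset.prod_ne_zero_iff.2 fun i _ => right_ne_zero_of_mul_eq_one (hgeo i)
  have key : PowerSeries.map (symmEval y : MvPolynomial (Fin k) K →ₐ[K] L).toRingHom
      (PowerSeries.mk (gPoly k t)) = PowerSeries.C (τ ^ k) +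
        ∑ i, PowerSeries.C (hlResidue τ y i) * PowerSeries.mk (fun r => y i ^ r) := by
    refine mul_right_cancel₀ hprod ?_
    simp only [← Polynomial.coeToPowerSeries.ringHom_apply, map_add, map_mul, map_prod, map_sum,
      map_sub, map_one] at h2
    simp only [Polynomial.coeToPowerSeries.ringHom_apply, Polynomial.coe_C, Polynomial.coe_X] at h2
    simp only [map_neg, map_one, neg_mul, one_mul, ← sub_eq_add_neg] at h1
    rw [h1]
    simp only [map_mul] at h2 ⊢
    rw [h2, add_mul, Finset.sum_mul]
    congr 1
    refine Finset.sum_congr rfl fun i _ => ?_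
    rw [← Finset.mul_prod_erase _ _ (Finset.mem_univ i), mul_assoc, ← mul_assoc (PowerSeries.mk _),
      hgeo, one_mul]
  have hr := congrArg (PowerSeries.coeff r) key
  simp only [PowerSeries.coeff_map, PowerSeries.coeff_mk, map_add, map_sum,
    PowerSeries.coeff_C_mul, PowerSeries.coeff_C] at hr
  rw [gSum]
  split_ifs with h
  · subst h
    have h0 : gPoly k t 0 = 1 := by
      have := congrArg (PowerSeries.coeff 0) (gGen_mul_eGen k t)
      simpa [eGen, eVar] using this
    rw [h0, if_pos rfl] at hr
    have hr : (1 : L) = τ ^ k + ∑ i, hlResidue τ y i * y i ^ 0 := by simpa using hr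
    rw [← algebraMap_eq, AlgHom.commutes, map_sub, map_one, map_pow]
    linear_combination hr
  · rw [if_neg h, zero_add] at hr
    exact hr

end

/-! ### Evaluating `R_μ` at points, and its recursion on the number of variables. -/

section

variable {K L : Type*} [Field K] [Field L] [Algebra K L]

/-- `R_μ` evaluated at the point with coordinates `y`. -/
def hlSum {k : ℕ} (t : L) (μ : Fin k → ℕ) (y : Fin k → L) : L :=
  ∑ w : Equiv.Perm (Fin k), (∏ i, y (w i) ^ μ i) *
    ∏ i, ∏ j ∈ Finset.Ioi i, (y (w i) - t * y (w j)) / (y (w i) - y (w j))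

/-- The product `∏_{i<j} (xᵢ - t xⱼ)`. -/
def hlKer (k : ℕ) (t : K) : MvPolynomial (Fin k) K :=
  ∏ i, ∏ j ∈ Finset.Ioi i, (X i - C t * X j)

lemma aeval_vdm_ne_zero {k : ℕ} {y : Fin k → L} (hy : Function.Injective y) :
    aeval y (vdm K k) ≠ 0 := by
  simp only [vdm, map_prod, map_sub, aeval_X]
  refine Finset.prod_ne_zero_iff.2 fun i _ => Finset.prod_ne_zero_iff.2 fun j hj => ?_
  exact sub_ne_zero.2 fun h => (Finset.mem_Ioi.1 hj).ne (hy h)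

lemma hlSum_mul_vdm {k : ℕ} (t : K) (μ : Fin k → ℕ) {y : Fin k → L} (hy : Function.Injective y) :
    hlSum (algebraMap K L t) μ y * aeval y (vdm K k) =
      aeval y (antisym ((∏ i, X i ^ μ i) * hlKer k t)) := by
  rw [hlSum, Finset.sum_mul, antisym, map_sum]
  refine Finset.sum_congr rfl fun w _ => ?_
  have hsq : ((Equiv.Perm.sign w : ℤ) : L) * ((Equiv.Perm.sign w : ℤ) : L) = 1 := by
    rw [← Int.cast_mul, ← Units.val_mul, Int.units_mul_self]
    simp
  have hd : ∏ i, ∏ j ∈ Finset.Ioi i, (y (w i) - y (w j)) =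
      ((Equiv.Perm.sign w : ℤ) : L) * aeval y (vdm K k) := by
    have := congrArg (aeval y) (rename_vdm (K := K) w)
    rw [map_mul, map_intCast] at this
    rw [← this]
    simp [vdm, map_prod]
  have hv := aeval_vdm_ne_zero (K := K) hy
  have hs0 : ((Equiv.Perm.sign w : ℤ) : L) ≠ 0 := left_ne_zero_of_mul_eq_one hsq
  simp_rw [Finset.prod_div_distrib]
  rw [hd, map_mul, map_intCast, aeval_rename]
  simp only [hlKer, map_mul, map_prod, map_pow, map_sub, aeval_X, Function.comp_apply,
    ← algebraMap_eq, AlgHom.commutes]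
  field_simp
  rw [pow_two, hsq, mul_one]

/-- The generic point of affine space. -/
def genPt (K : Type*) [Field K] (k : ℕ) : Fin k → FractionRing (MvPolynomial (Fin k) K) :=
  fun i => algebraMap (MvPolynomial (Fin k) K) _ (X i)

lemma aeval_genPt {k : ℕ} (p : MvPolynomial (Fin k) K) :
    aeval (genPt K k) p = algebraMap _ (FractionRing (MvPolynomial (Fin k) K)) p := by
  have : aeval (genPt K k) =
      IsScalarTower.toAlgHom K (MvPolynomial (Fin k) K) (FractionRing (MvPolynomial (Fin k) K)) :=
    algHom_ext fun i => by simp [genPt]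
  rw [this]
  rfl

lemma algebraMap_fractionRing_injective (k : ℕ) : Function.Injective
    (algebraMap (MvPolynomial (Fin k) K) (FractionRing (MvPolynomial (Fin k) K))) :=
  IsFractionRing.injective _ _

lemma genPt_injective (k : ℕ) : Function.Injective (genPt K k) := fun _ _ h =>
  X_injective (algebraMap_fractionRing_injective k h)

lemma genPt_ne_zero {k : ℕ} (i : Fin k) : genPt K k i ≠ 0 := by
  rw [genPt, Ne, IsFractionRing.to_map_eq_zero_iff]
  exact X_ne_zero i

lemma hlR_mul_vdm (k : ℕ) (t : K) (μ : Fin k → ℕ) :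
    (hlR k t μ).1 * vdm K k = antisym ((∏ i, X i ^ μ i) * hlKer k t) := by
  refine algebraMap_fractionRing_injective k ?_
  rw [map_mul, hlR, (exists_hlR k t μ).choose_spec, ← aeval_genPt, ← aeval_genPt,
    ← hlSum_mul_vdm t μ (genPt_injective k)]
  rfl

lemma aeval_hlR {k : ℕ} (t : K) (μ : Fin k → ℕ) {y : Fin k → L} (hy : Function.Injective y) :
    aeval y (hlR k t μ).1 = hlSum (algebraMap K L t) μ y := by
  refine mul_right_cancel₀ (aeval_vdm_ne_zero (K := K) hy) ?_
  rw [hlSum_mul_vdm t μ hy, ← hlR_mul_vdm, map_mul]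

/-- `R_μ` as a polynomial in `e₁, …, e_k`. -/
def hlRe (k : ℕ) (t : K) (μ : Fin k → ℕ) : MvPolynomial (Fin k) K :=
  (esymmAlgEquiv (Fin k) K (Fintype.card_fin k)).symm (hlR k t μ)

lemma symmEval_hlRe {k : ℕ} (t : K) (μ : Fin k → ℕ) {y : Fin k → L} (hy : Function.Injective y) :
    symmEval y (hlRe k t μ) = hlSum (algebraMap K L t) μ y := by
  rw [symmEval_eq, hlRe, AlgEquiv.apply_symm_apply, aeval_hlR t μ hy]

/-- Identities in `e₁, …, e_k` can thus be checked at the generic point, whose coordinates are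
distinct and nonzero. -/
lemma symmEval_genPt_injective (k : ℕ) :
    Function.Injective (symmEval (genPt K k) : MvPolynomial (Fin k) K → _) := by
  intro p q h
  rw [symmEval_eq, symmEval_eq, aeval_genPt, aeval_genPt] at h
  exact (esymmAlgEquiv (Fin k) K (Fintype.card_fin k)).injective
    (Subtype.ext (algebraMap_fractionRing_injective k h))

/-- The enumeration of the indices other than `i`. -/
def skip {k : ℕ} (i : Fin (k + 1)) (j : Fin k) : Fin (k + 1) := Equiv.swap 0 i j.succ

lemma skip_injective {k : ℕ} (i : Fin (k + 1)) : Function.Injective (skip i) :=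
  (Equiv.injective _).comp (Fin.succ_injective k)

lemma image_skip {k : ℕ} (i : Fin (k + 1)) :
    Finset.univ.map ⟨skip i, skip_injective i⟩ = Finset.univ.erase i := by
  refine Finset.eq_of_subset_of_card_le ?_ ?_
  · intro l hl
    obtain ⟨j, -, rfl⟩ := Finset.mem_map.1 hl
    refine Finset.mem_erase.2 ⟨fun h => ?_, Finset.mem_univ _⟩
    have : Equiv.swap 0 i j.succ = Equiv.swap 0 i 0 := by
      rw [Equiv.swap_apply_left]
      exact h
    exact Fin.succ_ne_zero j ((Equiv.injective _) this)
  · simp [Finset.card_erase_of_mem]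

lemma prod_skip {k : ℕ} {M : Type*} [CommMonoid M] (i : Fin (k + 1)) (f : Fin (k + 1) → M) :
    ∏ j, f (skip i j) = ∏ j ∈ Finset.univ.erase i, f j := by
  rw [← image_skip, Finset.prod_map]
  rfl

/-- Group the permutations by `i = w 0`: the factors pairing `yᵢ` with all other variables form the
residue up to `1 - t`, and the rest is a sum over permutations of the other indices. -/
lemma one_sub_mul_hlSum_succ {k : ℕ} (t : L) (μ : Fin (k + 1) → ℕ) (y : Fin (k + 1) → L) :
    (1 - t) * hlSum t μ y =
      ∑ i, hlResidue t y i * y i ^ μ 0 * hlSum t (fun j => μ j.succ) (fun j => y (skip i j)) := by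
  have h : hlSum t μ y = ∑ x : Fin (k + 1) × Equiv.Perm (Fin k),
      y x.1 ^ μ 0 * (∏ j, (y x.1 - t * y (skip x.1 j)) / (y x.1 - y (skip x.1 j))) *
        ((∏ j, y (skip x.1 (x.2 j)) ^ μ j.succ) * ∏ i, ∏ j ∈ Finset.Ioi i,
          (y (skip x.1 (x.2 i)) - t * y (skip x.1 (x.2 j))) /
            (y (skip x.1 (x.2 i)) - y (skip x.1 (x.2 j)))) := by
    rw [hlSum]
    refine Fintype.sum_equiv Equiv.Perm.decomposeFin _ _ fun w => ?_
    obtain ⟨⟨i, v⟩, rfl⟩ := Equiv.Perm.decomposeFin.symm.surjective w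
    rw [Equiv.apply_symm_apply]
    simp only [Fin.prod_univ_succ (n := k), Fin.prod_Ioi_zero, Fin.prod_Ioi_succ,
      Equiv.Perm.decomposeFin_symm_apply_zero, Equiv.Perm.decomposeFin_symm_apply_succ]
    rw [← Equiv.prod_comp v fun j => (y i - t * y (skip i j)) / (y i - y (skip i j))]
    -- `skip` uses the swap of `0` and `i` precisely because `Equiv.Perm.decomposeFin` produces it.
    simp only [skip]
    ring
  rw [h, Fintype.sum_prod_type, Finset.mul_sum]
  refine Finset.sum_congr rfl fun i _ => ?_
  dsimp only
  rw [← Finset.mul_sum, prod_skip i fun j => (y i - t * y j) / (y i - y j), hlResidue, hlSum]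
  ring

/-- Iterated, this turns symmetric functions of the variables other than `yᵢ` into polynomials in
`yᵢ` with coefficients symmetric in all variables. -/
lemma esymm_succ_eval {k : ℕ} (y : Fin (k + 1) → L) (i : Fin (k + 1)) (r : ℕ) :
    aeval (fun j => y (skip i j)) (esymm (Fin k) K (r + 1)) =
      aeval y (esymm (Fin (k + 1)) K (r + 1)) -
        y i * aeval (fun j => y (skip i j)) (esymm (Fin k) K r) := by
  have h := coeff_prod_one_add (K := K) y 1 (r + 1)
  rw [← Finset.mul_prod_erase _ _ (Finset.mem_univ i),
    ← prod_skip i fun j => 1 + PowerSeries.C (1 * y j) * PowerSeries.X, add_mul, one_mul, map_add,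
    mul_assoc, PowerSeries.coeff_C_mul, mul_comm PowerSeries.X, PowerSeries.coeff_succ_mul_X,
    coeff_prod_one_add (K := K) (fun j => y (skip i j)),
    coeff_prod_one_add (K := K) (fun j => y (skip i j))] at h
  simp only [one_pow, one_mul] at h
  linear_combination h

end

/-! ### The weight filtration, and `R_μ` with large first part. -/

section

variable {K L : Type*} [Field K] [Field L] [Algebra K L]

/-- The polynomials in `e₁, …, e_k` of weight at most `d`, where `e_r` has weight `r`. -/
def weightFil (K : Type*) [Field K] (k d : ℕ) : Submodule K (MvPolynomial (Fin k) K) :=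
  restrictSupport K {m | ⇑m ∈ weightLE (fun i : Fin k => (i : ℕ) + 1) d}

/-- Respecting a multiplicative filtration need only be checked on generators. It serves for
omitting a variable and for bounding total degree. -/
lemma weightFil_le_comap {k : ℕ} {B : Type*} [CommRing B] [Algebra K B]
    (θ : MvPolynomial (Fin k) K →ₐ[K] B) (S : ℕ → Submodule K B) (hmono : Monotone S)
    (h1 : 1 ∈ S 0) (hmul : ∀ {d e a b}, a ∈ S d → b ∈ S e → a * b ∈ S (d + e))
    (hX : ∀ i : Fin k, θ (X i) ∈ S (i + 1)) (d : ℕ) :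
    weightFil K k d ≤ (S d).comap θ.toLinearMap := by
  have hpow : ∀ (i : Fin k) (m : ℕ), θ (X i) ^ m ∈ S (((i : ℕ) + 1) * m) := by
    intro i m
    induction m with
    | zero => simpa using h1
    | succ m ih => rw [pow_succ, mul_add, mul_one]; exact hmul ih (hX i)
  rw [weightFil, restrictSupport_eq_span, Submodule.span_le]
  rintro _ ⟨m, hm, rfl⟩
  have hm : ∑ i : Fin k, ((i : ℕ) + 1) * m i ≤ d := hm
  refine hmono hm ?_
  change θ (monomial m 1) ∈ _
  rw [monomial_eq, map_one, one_mul, Finsupp.prod_fintype _ _ (fun _ => pow_zero _), map_prod]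
  simp only [map_pow]
  induction (Finset.univ : Finset (Fin k)) using Finset.cons_induction with
  | empty => simpa using h1
  | cons i s hi ih =>
    rw [Finset.prod_cons, Finset.sum_cons]
    exact hmul (hpow i (m i)) ih

lemma weightFil_mono (k : ℕ) : Monotone (weightFil K k) := fun _ _ h =>
  restrictSupport_mono _ fun _ hm => le_trans (show ∑ _, _ ≤ _ from hm) h

lemma C_mem_weightFil {k : ℕ} (c : K) (d : ℕ) : C c ∈ weightFil K k d := by
  rw [weightFil, ← monomial_zero', monomial_mem_restrictSupport]
  left
  change ∑ i, _ ≤ d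
  simp

lemma one_mem_weightFil (k d : ℕ) : 1 ∈ weightFil K k d := by
  rw [← C_1]
  exact C_mem_weightFil 1 d

lemma mul_mem_weightFil {k d e : ℕ} {a b : MvPolynomial (Fin k) K} (ha : a ∈ weightFil K k d)
    (hb : b ∈ weightFil K k e) : a * b ∈ weightFil K k (d + e) := by
  classical
  intro m hm
  obtain ⟨m1, h1, m2, h2, rfl⟩ := Finset.mem_add.1 (support_mul a b hm)
  have h1 : ∑ i, _ ≤ d := ha h1
  have h2 : ∑ i, _ ≤ e := hb h2
  change ∑ i : Fin k, ((i : ℕ) + 1) * (m1 + m2) i ≤ d + e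
  simp only [Finsupp.add_apply, mul_add, Finset.sum_add_distrib]
  exact add_le_add h1 h2

lemma X_mem_weightFil {k : ℕ} (i : Fin k) : X i ∈ weightFil K k (i + 1) := by
  rw [weightFil, X, monomial_mem_restrictSupport]
  left
  change ∑ j : Fin k, ((j : ℕ) + 1) * (Finsupp.single i 1) j ≤ _
  simp [Finsupp.single_apply]

lemma exists_mem_weightFil {k : ℕ} (p : MvPolynomial (Fin k) K) : ∃ d, p ∈ weightFil K k d := by
  refine ⟨p.support.sup fun m => ∑ i : Fin k, ((i : ℕ) + 1) * m i, fun m hm => ?_⟩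
  exact Finset.le_sup (f := fun m : Fin k →₀ ℕ => ∑ i : Fin k, ((i : ℕ) + 1) * m i) hm

lemma eVar_mem_weightFil (k r : ℕ) : eVar K k r ∈ weightFil K k r := by
  cases r with
  | zero => exact one_mem_weightFil k 0
  | succ r =>
    rw [eVar]
    split_ifs with h
    · exact X_mem_weightFil ⟨r, h⟩
    · exact zero_mem _

lemma smul_C_mul_mem {k : ℕ} {N : Submodule K (MvPolynomial (Fin k) K)} (c : K)
    {p : MvPolynomial (Fin k) K} (hp : p ∈ N) : C c * p ∈ N := by
  rw [C_mul']
  exact N.smul_mem c hp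

/-- The recursion for `g_r` coming from `G(u) E(-u) = E(-tu)`. -/
lemma gPoly_eq (k : ℕ) (t : K) (m : ℕ) :
    gPoly k t m = C ((-t) ^ m) * eVar K k m -
      ∑ j ∈ Finset.range m, C ((-1) ^ (j + 1)) * eVar K k (j + 1) * gPoly k t (m - 1 - j) := by
  have h := congrArg (PowerSeries.coeff m) (gGen_mul_eGen k t)
  rw [mul_comm, PowerSeries.coeff_mul, Finset.Nat.sum_antidiagonal_eq_sum_range_succ_mk,
    Finset.sum_range_succ'] at h
  simp only [eGen, PowerSeries.coeff_mk, pow_zero, map_one, one_mul, Nat.sub_zero] at h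
  rw [← h]
  simp only [show eVar K k 0 = 1 from rfl, one_mul]
  rw [add_comm, add_sub_assoc, left_eq_add, sub_eq_zero]
  refine Finset.sum_congr rfl fun j _ => ?_
  rw [Nat.sub_sub, add_comm 1 j]

lemma gPoly_mem_weightFil (k : ℕ) (t : K) (r : ℕ) : gPoly k t r ∈ weightFil K k r := by
  induction r using Nat.strong_induction_on with
  | _ r ih =>
    rw [gPoly_eq]
    refine sub_mem (smul_C_mul_mem _ (eVar_mem_weightFil k r)) (sum_mem fun j hj => ?_)
    have hj := Finset.mem_range.1 hj
    have := mul_mem_weightFil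
      (smul_C_mul_mem ((-1) ^ (j + 1)) (eVar_mem_weightFil (K := K) k (j + 1)))
      (ih (r - 1 - j) (by omega))
    rwa [show j + 1 + (r - 1 - j) = r by omega] at this

lemma gSum_mem_weightFil (k : ℕ) (t : K) (r : ℕ) : gSum k t r ∈ weightFil K k r := by
  rw [gSum]
  split_ifs
  · exact C_mem_weightFil _ _
  · exact gPoly_mem_weightFil k t r

/-- The part of weight at most `d` of the ideal generated by `g_n, …, g_{n+k-1}`. -/
def gIdealFil (k n : ℕ) (t : K) (d : ℕ) : Submodule K (MvPolynomial (Fin k) K) :=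
  Submodule.span K {p | ∃ i < k, ∃ e, ∃ b ∈ weightFil K k e,
    n + i + e ≤ d ∧ p = gPoly k t (n + i) * b}

lemma mul_mem_gIdealFil {k n : ℕ} {t : K} {d e : ℕ} {a b : MvPolynomial (Fin k) K}
    (ha : a ∈ weightFil K k e) (hb : b ∈ gIdealFil k n t d) :
    a * b ∈ gIdealFil k n t (e + d) := by
  induction hb using Submodule.span_induction with
  | mem p hp =>
    obtain ⟨i, hi, f, b, hb, hd, rfl⟩ := hp
    exact Submodule.subset_span ⟨i, hi, e + f, a * b, mul_mem_weightFil ha hb, by omega, by ring⟩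
  | zero => rw [mul_zero]; exact zero_mem _
  | add p q _ _ hp hq => rw [mul_add]; exact add_mem hp hq
  | smul c p _ hp => rw [mul_smul_comm]; exact Submodule.smul_mem _ _ hp

lemma gIdealFil_mono (k n : ℕ) (t : K) : Monotone (gIdealFil k n t) := fun _ _ h =>
  Submodule.span_mono fun _ ⟨i, hi, e, b, hb, hd, hp⟩ => ⟨i, hi, e, b, hb, hd.trans h, hp⟩

/-- For `m ≥ n + k` one has `m > k`, so `e_m = 0` and the recursion involves only `g_{m-1}, …,
g_{m-k}`, all of index at least `n`. -/
lemma gPoly_mem_gIdealFil {k n : ℕ} (hn : 1 ≤ n) (t : K) {m : ℕ} (hm : n ≤ m) :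
    gPoly k t m ∈ gIdealFil k n t m := by
  induction m using Nat.strong_induction_on with
  | _ m ih =>
    by_cases h : m < n + k
    · exact Submodule.subset_span ⟨m - n, by omega, 0, 1, one_mem_weightFil k 0, by omega, by
        rw [mul_one, Nat.add_sub_cancel' hm]⟩
    · have hz : ∀ r, k < r → eVar K k r = 0 := by
        rintro (_ | r) hr
        · omega
        · rw [eVar, dif_neg (by omega)]
      rw [gPoly_eq, hz m (by omega), mul_zero]
      refine sub_mem (zero_mem _) (sum_mem fun j hj => ?_)
      have hj := Finset.mem_range.1 hj
      by_cases hjk : k < j + 1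
      · rw [hz _ hjk, mul_zero, zero_mul]
        exact zero_mem _
      · have := mul_mem_gIdealFil
          (smul_C_mul_mem ((-1) ^ (j + 1)) (eVar_mem_weightFil (K := K) k (j + 1)))
          (ih (m - 1 - j) (by omega) (by omega))
        rwa [show j + 1 + (m - 1 - j) = m by omega] at this

/-- Combinations of the `g_{m+s}` with coefficients of weight at most `d - s`. -/
def gSumFil (k : ℕ) (t : K) (m d : ℕ) : Submodule K (MvPolynomial (Fin k) K) :=
  Submodule.span K {p | ∃ e s, ∃ b ∈ weightFil K k e, e + s ≤ d ∧ p = b * gSum k t (m + s)}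

lemma gSumFil_le_weightFil (k : ℕ) (t : K) (m d : ℕ) :
    gSumFil k t m d ≤ weightFil K k (m + d) := by
  refine Submodule.span_le.2 ?_
  rintro _ ⟨e, s, b, hb, hd, rfl⟩
  exact weightFil_mono k (by omega) (mul_mem_weightFil hb (gSum_mem_weightFil k t (m + s)))

lemma gSumFil_le_gIdealFil {k n : ℕ} (hn : 1 ≤ n) (t : K) {m : ℕ} (hm : n ≤ m) (d : ℕ) :
    gSumFil k t m d ≤ gIdealFil k n t (m + d) := by
  refine Submodule.span_le.2 ?_
  rintro _ ⟨e, s, b, hb, hd, rfl⟩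
  rw [gSum, if_neg (by omega)]
  exact gIdealFil_mono k n t (by omega)
    (mul_mem_gIdealFil hb (gPoly_mem_gIdealFil hn t (by omega : n ≤ m + s)))

/-- Families `i ↦ ∑ aₛ yᵢˢ` with `aₛ` symmetric of weight at most `d - s`. -/
def coordFil {k : ℕ} (K : Type*) [Field K] [Algebra K L] (y : Fin k → L) (d : ℕ) :
    Submodule K (Fin k → L) :=
  Submodule.span K {q | ∃ e s, ∃ b ∈ weightFil K k e, e + s ≤ d ∧
    q = fun i => symmEval y b * y i ^ s}

lemma coordFil_mono {k : ℕ} (y : Fin k → L) : Monotone (coordFil K y) := fun _ _ h =>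
  Submodule.span_mono fun _ ⟨e, s, b, hb, hd, hp⟩ => ⟨e, s, b, hb, hd.trans h, hp⟩

lemma mul_mem_coordFil {k : ℕ} {y : Fin k → L} {d e : ℕ} {p q : Fin k → L}
    (hp : p ∈ coordFil K y d) (hq : q ∈ coordFil K y e) : p * q ∈ coordFil K y (d + e) := by
  have h := Submodule.mul_mem_mul hp hq
  rw [coordFil, coordFil, Submodule.span_mul_span] at h
  refine Submodule.span_mono ?_ h
  rintro _ ⟨_, ⟨e1, s1, b1, hb1, h1, rfl⟩, _, ⟨e2, s2, b2, hb2, h2, rfl⟩, rfl⟩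
  refine ⟨e1 + e2, s1 + s2, b1 * b2, mul_mem_weightFil hb1 hb2, by omega, ?_⟩
  funext i
  simp only [Pi.mul_apply, map_mul]
  ring

lemma symmEval_mem_coordFil {k : ℕ} (y : Fin k → L) {d : ℕ} {b : MvPolynomial (Fin k) K}
    (hb : b ∈ weightFil K k d) : (fun _ => symmEval y b) ∈ coordFil K y d :=
  Submodule.subset_span ⟨d, 0, b, hb, le_rfl, by simp⟩

lemma symmEval_skip_mem_coordFil {k : ℕ} (y : Fin (k + 1) → L) {d : ℕ}
    {p : MvPolynomial (Fin k) K} (hp : p ∈ weightFil K k d) :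
    (fun i => symmEval (fun j => y (skip i j)) p) ∈ coordFil K y d := by
  have hone : (1 : Fin (k + 1) → L) ∈ coordFil K y 0 := by
    have := symmEval_mem_coordFil y (one_mem_weightFil (K := K) (k + 1) 0)
    rwa [map_one] at this
  have he : ∀ r, (fun i => aeval (fun j => y (skip i j)) (esymm (Fin k) K r)) ∈
      coordFil K y r := by
    intro r
    induction r with
    | zero =>
      simp only [esymm_zero, map_one]
      exact hone
    | succ r ih =>
      simp only [esymm_succ_eval]
      refine sub_mem ?_ ?_
      · simp only [← symmEval_eVar]
        exact symmEval_mem_coordFil y (eVar_mem_weightFil _ _)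
      · rw [add_comm r]
        refine mul_mem_coordFil (p := y) (Submodule.subset_span ?_) ih
        exact ⟨0, 1, 1, one_mem_weightFil _ _, by simp, by simp⟩
  exact weightFil_le_comap (B := Fin (k + 1) → L)
    (AlgHom.pi fun i => symmEval fun j => y (skip i j)) (coordFil K y)
    (coordFil_mono y) hone mul_mem_coordFil (fun i => by
      have := he (i + 1)
      convert this using 2
      simp [symmEval]) d hp

/-- A term `a yᵢ^s` with `a` symmetric contributes `a ∑ cᵢ yᵢ^(m+s)`, which is `a` times `gSum` at
`m + s`. -/
lemma sum_hlResidue_mul_mem {k : ℕ} (t : K) {y : Fin k → L} (hy : Function.Injective y)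
    (hy0 : ∀ i, y i ≠ 0) (m : ℕ) {d : ℕ} {q : Fin k → L} (hq : q ∈ coordFil K y d) :
    ∃ p ∈ gSumFil k t m d,
      symmEval y p = ∑ i, hlResidue (algebraMap K L t) y i * y i ^ m * q i := by
  induction hq using Submodule.span_induction with
  | mem q h =>
    obtain ⟨e, s, b, hb, hd, rfl⟩ := h
    refine ⟨b * gSum k t (m + s), Submodule.subset_span ⟨e, s, b, hb, hd, rfl⟩, ?_⟩
    rw [map_mul, symmEval_gSum t hy hy0, Finset.mul_sum]
    refine Finset.sum_congr rfl fun i _ => ?_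
    ring
  | zero => exact ⟨0, zero_mem _, by simp⟩
  | add q₁ q₂ _ _ h₁ h₂ =>
    obtain ⟨p₁, hp₁, e₁⟩ := h₁
    obtain ⟨p₂, hp₂, e₂⟩ := h₂
    exact ⟨p₁ + p₂, add_mem hp₁ hp₂, by simp [e₁, e₂, mul_add, Finset.sum_add_distrib]⟩
  | smul c q _ h =>
    obtain ⟨p, hp, e⟩ := h
    exact ⟨c • p, Submodule.smul_mem _ _ hp, by simp [e, Finset.smul_sum]⟩

lemma hlRe_succ_mem_gSumFil {k : ℕ} {t : K} (ht : t ≠ 1) (μ : Fin (k + 1) → ℕ) {d : ℕ}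
    (h : hlRe k t (fun j => μ j.succ) ∈ weightFil K k d) :
    hlRe (k + 1) t μ ∈ gSumFil (k + 1) t (μ 0) d := by
  have hy := genPt_injective (K := K) (k + 1)
  obtain ⟨p, hp, e⟩ := sum_hlResidue_mul_mem t hy genPt_ne_zero (μ 0)
    (symmEval_skip_mem_coordFil (genPt K (k + 1)) h)
  have hp' : p = (1 - t) • hlRe (k + 1) t μ := by
    refine symmEval_genPt_injective (k + 1) ?_
    rw [e, map_smul, symmEval_hlRe t μ hy, Algebra.smul_def, map_sub, map_one,
      one_sub_mul_hlSum_succ]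
    refine Finset.sum_congr rfl fun i _ => ?_
    rw [symmEval_hlRe t _ (fun _ _ h => skip_injective i (hy h))]
  have : hlRe (k + 1) t μ = (1 - t)⁻¹ • p := by
    rw [hp', smul_smul, inv_mul_cancel₀ (sub_ne_zero.2 ht.symm), one_smul]
  rw [this]
  exact Submodule.smul_mem _ _ hp

lemma hlRe_mem_weightFil {k : ℕ} {t : K} (ht : t ≠ 1) (μ : Fin k → ℕ) :
    hlRe k t μ ∈ weightFil K k (∑ i, μ i) := by
  induction k with
  | zero =>
    obtain ⟨c, hc⟩ := C_surjective (Fin 0) (hlRe 0 t μ)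
    rw [← hc]
    exact C_mem_weightFil _ _
  | succ k ih =>
    rw [Fin.sum_univ_succ]
    exact gSumFil_le_weightFil _ _ _ _ (hlRe_succ_mem_gSumFil ht μ (ih fun j => μ j.succ))

lemma hlRe_mem_gIdealFil {k n : ℕ} {t : K} (ht : t ≠ 1) (hn : 1 ≤ n) (μ : Fin (k + 1) → ℕ)
    (hμ : n ≤ μ 0) : hlRe (k + 1) t μ ∈ gIdealFil (k + 1) n t (∑ i, μ i) := by
  rw [Fin.sum_univ_succ]
  exact gSumFil_le_gIdealFil hn t hμ _
    (hlRe_succ_mem_gSumFil ht μ (hlRe_mem_weightFil ht fun j => μ j.succ))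

/-- For `μ = 0` the inner sum of the recursion is constant, leaving the total residue `1 - t^(k+1)`
at each stage. -/
lemma one_sub_pow_mul_hlSum_zero {k : ℕ} (t : K) {y : Fin k → L} (hy : Function.Injective y)
    (hy0 : ∀ i, y i ≠ 0) :
    (1 - algebraMap K L t) ^ k * hlSum (algebraMap K L t) (fun _ => 0) y =
      algebraMap K L (tPoch t k) := by
  induction k with
  | zero => simp [hlSum, tPoch]
  | succ k ih =>
    rw [pow_succ, mul_assoc, one_sub_mul_hlSum_succ, Finset.mul_sum, tPoch, Finset.prod_range_succ,
      map_mul]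
    have h := symmEval_gSum t hy hy0 0
    rw [gSum, if_pos rfl, ← algebraMap_eq, AlgHom.commutes] at h
    rw [h, Finset.mul_sum]
    refine Finset.sum_congr rfl fun i _ => ?_
    rw [← tPoch, ← ih (hy.comp (skip_injective i)) fun j => hy0 _]
    simp only [Function.comp_def]
    ring

lemma one_sub_pow_mul_hlR_zero (k : ℕ) (t : K) :
    C ((1 - t) ^ k) * (hlR k t fun _ => 0).1 = C (tPoch t k) := by
  refine algebraMap_fractionRing_injective k ?_
  have := one_sub_pow_mul_hlSum_zero t (genPt_injective (K := K) k) genPt_ne_zero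
  rw [← aeval_hlR t _ (genPt_injective k), aeval_genPt] at this
  rw [map_mul, ← algebraMap_eq, ← IsScalarTower.algebraMap_apply, ← IsScalarTower.algebraMap_apply,
    ← this]
  simp

end

/-! ### Straightening, and spanning by the `R_λ` of partitions. -/

section

variable {K : Type*} [Field K]

/-- The monomial with exponents `μ`. -/
def monom (K : Type*) [Field K] {k : ℕ} (μ : Fin k → ℕ) : MvPolynomial (Fin k) K := ∏ i, X i ^ μ i

lemma monom_add_single {k : ℕ} (μ : Fin k → ℕ) (i : Fin k) :
    monom K (μ + Pi.single i 1) = monom K μ * X i := by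
  simp only [monom, Pi.add_apply, pow_add, Finset.prod_mul_distrib]
  congr 1
  rw [Finset.prod_eq_single i (fun j _ hj => by simp [hj]) (by simp)]
  simp

lemma rename_swap_monom {k : ℕ} (a b : Fin k) (μ : Fin k → ℕ) :
    rename (Equiv.swap a b) (monom K μ) = monom K fun i => μ (Equiv.swap a b i) := by
  rw [monom, monom, map_prod, ← Equiv.prod_comp (Equiv.swap a b)]
  simp

lemma antisym_add {k : ℕ} (f g : MvPolynomial (Fin k) K) :
    antisym (f + g) = antisym f + antisym g := by
  simp [antisym, mul_add, Finset.sum_add_distrib]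

lemma antisym_mul_of_isSymmetric {k : ℕ} {f : MvPolynomial (Fin k) K} (hf : f.IsSymmetric)
    (g : MvPolynomial (Fin k) K) : antisym (f * g) = f * antisym g := by
  rw [antisym, antisym, Finset.mul_sum]
  refine Finset.sum_congr rfl fun w _ => ?_
  rw [map_mul, hf w]
  ring

lemma antisym_C_mul {k : ℕ} (c : K) (g : MvPolynomial (Fin k) K) :
    antisym (C c * g) = C c * antisym g :=
  antisym_mul_of_isSymmetric (IsSymmetric.C c) g

lemma antisym_sum {k : ℕ} {ι : Type*} (s : Finset ι) (f : ι → MvPolynomial (Fin k) K) :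
    antisym (∑ i ∈ s, f i) = ∑ i ∈ s, antisym (f i) := by
  simp only [antisym, map_sum, Finset.mul_sum]
  exact Finset.sum_comm

lemma antisym_eq_zero {k : ℕ} {a b : Fin k} (hab : a ≠ b) {f : MvPolynomial (Fin k) K}
    (hf : rename (Equiv.swap a b) f = f) : antisym f = 0 := by
  refine Finset.sum_involution (fun w _ => w * Equiv.swap a b) ?_ ?_ ?_ ?_
  · intro w _
    rw [Equiv.Perm.coe_mul, ← rename_rename, hf, map_mul, Equiv.Perm.sign_swap hab]
    simp
  · intro w _ _ h
    exact hab (Equiv.swap_eq_one_iff.1 (mul_eq_left.1 h))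
  · intro w _
    exact Finset.mem_univ _
  · intro w _
    simp [mul_assoc]

/-- For adjacent indices, `(a, b)` is the only pair whose order the transposition reverses; the
other factors are permuted. -/
lemma exists_hlKer_eq {k : ℕ} {a b : Fin k} (hab : (b : ℕ) = a + 1) (t : K) :
    ∃ S : MvPolynomial (Fin k) K, rename (Equiv.swap a b) S = S ∧
      hlKer k t = (X a - C t * X b) * S := by
  have hlt : a < b := by omega
  have h : hlKer k t = ∏ p ∈ Finset.univ.filter fun p : Fin k × Fin k => p.1 < p.2,
      (X p.1 - C t * X p.2) := by
    rw [hlKer, Finset.prod_filter, Fintype.prod_prod_type]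
    refine Finset.prod_congr rfl fun i _ => ?_
    rw [← Finset.prod_filter]
    congr 1
    ext j
    simp
  refine ⟨∏ p ∈ (Finset.univ.filter fun p : Fin k × Fin k => p.1 < p.2).erase (a, b),
    (X p.1 - C t * X p.2), ?_, ?_⟩
  · rw [map_prod]
    refine Finset.prod_equiv ((Equiv.swap a b).prodCongr (Equiv.swap a b)) ?_ ?_
    · rintro ⟨i, j⟩
      simp only [Finset.mem_erase, Finset.mem_filter, Finset.mem_univ, true_and, ne_eq,
        Prod.mk.injEq, Equiv.prodCongr_apply, Prod.map_apply, Equiv.swap_apply_def, Fin.ext_iff,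
        Fin.lt_def]
      split_ifs <;> omega
    · rintro ⟨i, j⟩ _
      simp
  · rw [h, ← Finset.mul_prod_erase _ _ (a := (a, b)) (by simpa using hlt)]

/-- The antisymmetrisation of `f ∏_{i<j} (xᵢ - t xⱼ)`. -/
def hlAntisym {k : ℕ} (t : K) (f : MvPolynomial (Fin k) K) : MvPolynomial (Fin k) K :=
  antisym (f * hlKer k t)

/-- Multiplying `f` by `x_b - t x_a` makes the product with the kernel invariant under the swap, so
its antisymmetrisation vanishes. -/
lemma hlAntisym_mul_eq_zero {k : ℕ} {a b : Fin k} (hab : (b : ℕ) = a + 1) (t : K)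
    {f : MvPolynomial (Fin k) K} (hf : rename (Equiv.swap a b) f = f) :
    hlAntisym t (f * X b) = C t * hlAntisym t (f * X a) := by
  have hne : a ≠ b := by
    rintro rfl
    omega
  obtain ⟨S, hS, hker⟩ := exists_hlKer_eq hab t
  have h0 : antisym (f * (X b - C t * X a) * hlKer k t) = 0 := by
    refine antisym_eq_zero hne ?_
    rw [hker]
    simp only [map_mul, map_sub, rename_X, rename_C, hf, hS, Equiv.swap_apply_left,
      Equiv.swap_apply_right]
    ring
  have h1 : f * X b * hlKer k t =
      f * (X b - C t * X a) * hlKer k t + C t * (f * X a * hlKer k t) := by ring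
  rw [hlAntisym, h1, antisym_add, antisym_C_mul, h0, zero_add, hlAntisym]

lemma hlR_mul_vdm_eq {k : ℕ} (t : K) (μ : Fin k → ℕ) :
    (hlR k t μ).1 * vdm K k = hlAntisym t (monom K μ) := hlR_mul_vdm k t μ

lemma hlRe_eq_of {k : ℕ} {μ ν : Fin k → ℕ} {t : K}
    (h : hlAntisym t (monom K μ) = C t * hlAntisym t (monom K ν)) :
    hlRe k t μ = t • hlRe k t ν := by
  rw [hlRe, hlRe, ← map_smul]
  congr 1
  refine Subtype.ext (mul_right_cancel₀ (vdm_ne_zero k) ?_)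
  rw [hlR_mul_vdm_eq, h, ← hlR_mul_vdm_eq, ← mul_assoc, C_mul']
  rfl

lemma hlRe_eq_of_add {k : ℕ} {μ μ' ν ν' : Fin k → ℕ} {t : K}
    (h : hlAntisym t (monom K μ) + hlAntisym t (monom K μ') =
      C t * (hlAntisym t (monom K ν) + hlAntisym t (monom K ν'))) :
    hlRe k t μ = t • (hlRe k t ν + hlRe k t ν') - hlRe k t μ' := by
  rw [eq_sub_iff_add_eq, hlRe, hlRe, hlRe, hlRe, ← map_add, ← map_add, ← map_smul]
  congr 1
  refine Subtype.ext (mul_right_cancel₀ (vdm_ne_zero k) ?_)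
  change ((hlR k t μ).1 + (hlR k t μ').1) * vdm K k =
    (t • ((hlR k t ν).1 + (hlR k t ν').1)) * vdm K k
  rw [← C_mul', mul_assoc, add_mul, add_mul]
  simpa only [hlR_mul_vdm_eq] using h

/-- The span of the `R_λ` for partitions `λ` of `d`. -/
def hlSpan (k : ℕ) (t : K) (d : ℕ) : Submodule K (MvPolynomial (Fin k) K) :=
  Submodule.span K {p | ∃ lam : Fin k → ℕ, Antitone lam ∧ ∑ i, lam i = d ∧ p = hlRe k t lam}

lemma sum_comp_swap {k : ℕ} (a b : Fin k) (ν : Fin k → ℕ) :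
    ∑ i, ν (Equiv.swap a b i) = ∑ i, ν i := Equiv.sum_comp _ _

lemma sum_index_mul_swap_lt {k : ℕ} {a b : Fin k} (hab : a < b) {ν : Fin k → ℕ}
    (h : ν a < ν b) :
    ∑ i : Fin k, (i : ℕ) * ν (Equiv.swap a b i) < ∑ i : Fin k, (i : ℕ) * ν i := by
  have hb : b ∈ Finset.univ.erase a := Finset.mem_erase.2 ⟨hab.ne', Finset.mem_univ b⟩
  have hrest : ∑ i ∈ (Finset.univ.erase a).erase b, (i : ℕ) * ν (Equiv.swap a b i) =
      ∑ i ∈ (Finset.univ.erase a).erase b, (i : ℕ) * ν i := by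
    refine Finset.sum_congr rfl fun i hi => ?_
    simp only [Finset.mem_erase] at hi
    rw [Equiv.swap_apply_of_ne_of_ne hi.2.1 hi.1]
  rw [← Finset.add_sum_erase _ _ (Finset.mem_univ a), ← Finset.add_sum_erase _ _ hb,
    ← Finset.add_sum_erase _ (fun i : Fin k => (i : ℕ) * ν i) (Finset.mem_univ a),
    ← Finset.add_sum_erase _ (fun i : Fin k => (i : ℕ) * ν i) hb, hrest, Equiv.swap_apply_left,
    Equiv.swap_apply_right]
  have : (a : ℕ) < b := hab
  nlinarith

/-- Straightening: every `R_μ` is a combination of `R_λ` for partitions `λ`. -/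
lemma hlRe_mem_hlSpan {k : ℕ} (t : K) (μ : Fin (k + 1) → ℕ) :
    hlRe (k + 1) t μ ∈ hlSpan (k + 1) t (∑ i, μ i) := by
  -- The induction measure `∑ i μᵢ` falls when weight moves to earlier positions.
  obtain ⟨m, hm⟩ : ∃ m, ∑ i : Fin (k + 1), (i : ℕ) * μ i = m := ⟨_, rfl⟩
  induction m using Nat.strong_induction_on generalizing μ with
  | _ m ih =>
    subst hm
    by_cases hanti : Antitone μ
    · exact Submodule.subset_span ⟨μ, hanti, rfl, rfl⟩
    rw [Fin.antitone_iff_succ_le] at hanti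
    push Not at hanti
    obtain ⟨i, hi⟩ := hanti
    have hab : ((i.succ : Fin (k + 1)) : ℕ) = (i.castSucc : Fin (k + 1)) + 1 := by simp
    generalize i.succ = b at hi hab
    generalize i.castSucc = a at hi hab
    have hlt : a < b := by omega
    -- An ascent `μ_a < μ_b` forces `μ_b ≥ 1`, so a factor `x_b` can be split off.
    obtain ⟨ν, rfl⟩ : ∃ ν : Fin (k + 1) → ℕ, μ = ν + Pi.single b 1 := by
      refine ⟨μ - Pi.single b 1, ?_⟩
      rw [tsub_add_cancel_of_le]
      intro j
      by_cases hj : j = b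
      · subst hj
        simp only [Pi.single_eq_same]
        omega
      · simp [hj]
    have hνb : (ν + Pi.single b 1 : Fin (k + 1) → ℕ) b = ν b + 1 := by simp
    have hνa : (ν + Pi.single b 1 : Fin (k + 1) → ℕ) a = ν a := by simp [hlt.ne]
    rw [hνa, hνb] at hi
    have hsum : ∀ (κ : Fin (k + 1) → ℕ) (c : Fin (k + 1)),
        ∑ i, (κ + Pi.single c 1 : Fin (k + 1) → ℕ) i = ∑ i, κ i + 1 := fun κ c => by
      simp [Finset.sum_add_distrib]
    have hmeas : ∀ (κ : Fin (k + 1) → ℕ) (c : Fin (k + 1)),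
        ∑ i : Fin (k + 1), (i : ℕ) * (κ + Pi.single c 1 : Fin (k + 1) → ℕ) i =
          ∑ i : Fin (k + 1), (i : ℕ) * κ i + c := fun κ c => by
      simp [mul_add, Finset.sum_add_distrib, Pi.single_apply]
    have hred : ∀ (κ : Fin (k + 1) → ℕ) (c : Fin (k + 1)), ∑ i, κ i = ∑ i, ν i →
        ∑ i : Fin (k + 1), (i : ℕ) * κ i + c < ∑ i : Fin (k + 1), (i : ℕ) * ν i + b →
        hlRe (k + 1) t (κ + Pi.single c 1) ∈
          hlSpan (k + 1) t (∑ i, (ν + Pi.single b 1 : Fin (k + 1) → ℕ) i) := by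
      intro κ c h1 h2
      have := ih _ (by rw [hmeas ν b]; exact h2) (κ + Pi.single c 1) (hmeas κ c)
      rwa [hsum, h1, ← hsum ν b] at this
    have hνa_mem : hlRe (k + 1) t (ν + Pi.single a 1) ∈
          hlSpan (k + 1) t (∑ i, (ν + Pi.single b 1 : Fin (k + 1) → ℕ) i) := hred ν a rfl (by omega)
    rcases (Nat.lt_succ_iff.1 hi).eq_or_lt with heq | hlt'
    · have hsymm : rename (Equiv.swap a b) (monom K ν) = monom K ν := by
        rw [rename_swap_monom]
        congr 1
        funext i
        rw [Equiv.swap_apply_def]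
        split_ifs with h1 h2
        · rw [h1, heq]
        · rw [h2, heq]
        · rfl
      have h := hlAntisym_mul_eq_zero hab t hsymm
      rw [← monom_add_single, ← monom_add_single] at h
      rw [hlRe_eq_of h]
      exact Submodule.smul_mem _ _ hνa_mem
    -- Here `x^ν` is not swap-invariant, so its mirror image is added; the three other monomials in
    -- the resulting relation have smaller measure.
    · have hsymm : rename (Equiv.swap a b)
          (monom K ν + monom K fun i => ν (Equiv.swap a b i)) =
          monom K ν + monom K fun i => ν (Equiv.swap a b i) := by
        rw [map_add, rename_swap_monom, rename_swap_monom]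
        simp only [Equiv.swap_apply_self]
        exact add_comm _ _
      have h := hlAntisym_mul_eq_zero hab t hsymm
      have hadd : ∀ f g : MvPolynomial (Fin (k + 1)) K,
          hlAntisym t (f + g) = hlAntisym t f + hlAntisym t g := fun f g => by
        rw [hlAntisym, add_mul, antisym_add, hlAntisym, hlAntisym]
      rw [add_mul, add_mul, hadd, hadd, ← monom_add_single, ← monom_add_single,
        ← monom_add_single, ← monom_add_single] at h
      rw [hlRe_eq_of_add h]
      have hs := sum_index_mul_swap_lt hlt hlt'
      have hs' := sum_comp_swap a b ν
      refine sub_mem (Submodule.smul_mem _ _ (add_mem hνa_mem ?_)) ?_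
      · exact hred _ a hs' (by omega)
      · exact hred _ b hs' (by omega)

/-- A symmetric factor passes inside the antisymmetrisation, where it is expanded into monomials. -/
lemma mul_hlRe_zero {k : ℕ} (t : K) (p : MvPolynomial (Fin k) K) :
    p * hlRe k t (fun _ => 0) =
      ∑ m ∈ (esymmAlgEquiv (Fin k) K (Fintype.card_fin k) p).1.support,
        (esymmAlgEquiv (Fin k) K (Fintype.card_fin k) p).1.coeff m • hlRe k t m := by
  set e := esymmAlgEquiv (Fin k) K (Fintype.card_fin k)
  refine e.injective ?_
  simp only [map_mul, map_sum, map_smul, hlRe, e, AlgEquiv.apply_symm_apply]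
  change e p * _ = _
  refine Subtype.ext (mul_right_cancel₀ (vdm_ne_zero k) ?_)
  change (e p).1 * (hlR k t fun _ => 0).1 * vdm K k = _
  have hone : monom K (fun _ : Fin k => 0) = 1 := by simp [monom]
  have hsupp : (e p).1 = ∑ m ∈ (e p).1.support, C ((e p).1.coeff m) * monom K m := by
    conv_lhs => rw [(e p).1.as_sum]
    refine Finset.sum_congr rfl fun m _ => ?_
    rw [monomial_eq, monom, Finsupp.prod_fintype _ _ (fun _ => pow_zero _)]
  rw [mul_assoc, hlR_mul_vdm_eq, hone, hlAntisym, one_mul,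
    ← antisym_mul_of_isSymmetric (e p).2]
  conv_lhs => rw [hsupp]
  rw [Finset.sum_mul, antisym_sum, AddSubmonoidClass.coe_finsetSum, Finset.sum_mul]
  refine Finset.sum_congr rfl fun m _ => ?_
  rw [mul_assoc, antisym_C_mul, ← hlAntisym, ← hlR_mul_vdm_eq, ← mul_assoc, C_mul']
  rfl

lemma tPoch_ne_zero {t : K} (ht : ∀ m, 0 < m → t ^ m ≠ 1) (k : ℕ) : tPoch t k ≠ 0 :=
  Finset.prod_ne_zero_iff.2 fun j _ => sub_ne_zero.2 (ht (j + 1) j.succ_pos).symm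

lemma totalDegree_esymm_le {k : ℕ} (r : ℕ) : (esymm (Fin k) K r).totalDegree ≤ r := by
  refine totalDegree_finsetSum_le fun s hs => ?_
  refine (totalDegree_finsetProd _ _).trans ?_
  simp [totalDegree_X, (Finset.mem_powersetCard.1 hs).2]

lemma totalDegree_esymmAlgEquiv_le {k d : ℕ} {p : MvPolynomial (Fin k) K}
    (hp : p ∈ weightFil K k d) :
    (esymmAlgEquiv (Fin k) K (Fintype.card_fin k) p).1.totalDegree ≤ d := by
  have h := weightFil_le_comap (aeval fun i : Fin k => esymm (Fin k) K (i + 1))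
    (fun d => restrictTotalDegree (Fin k) K d)
    (fun a b hab p hp => by
      rw [mem_restrictTotalDegree] at hp ⊢
      exact hp.trans hab)
    (by rw [mem_restrictTotalDegree]; simp)
    (fun {d e a b} ha hb => by
      rw [mem_restrictTotalDegree] at ha hb ⊢
      exact (totalDegree_mul _ _).trans (add_le_add ha hb))
    (fun i => by
      rw [mem_restrictTotalDegree, aeval_X]
      exact totalDegree_esymm_le _) d hp
  rw [Submodule.mem_comap, mem_restrictTotalDegree] at h
  exact (congrArg totalDegree (esymmAlgHom_apply p)).trans_le h

/-- The Hall–Littlewood polynomials of partitions span, compatibly with the weight filtration. -/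
lemma mem_span_hlRe_of_mem_weightFil {k : ℕ} {t : K} (ht : ∀ m, 0 < m → t ^ m ≠ 1) {d : ℕ}
    {p : MvPolynomial (Fin (k + 1)) K} (hp : p ∈ weightFil K (k + 1) d) :
    p ∈ Submodule.span K {q | ∃ lam : Fin (k + 1) → ℕ, Antitone lam ∧ ∑ i, lam i ≤ d ∧
      q = hlRe (k + 1) t lam} := by
  -- `R_0` is a nonzero scalar, so expanding `p R_0` expands `p` itself.
  have h0 : (1 - t) ^ (k + 1) • hlRe (k + 1) t (fun _ => 0) = C (tPoch t (k + 1)) := by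
    rw [hlRe, ← map_smul, AlgEquiv.symm_apply_eq]
    refine Subtype.ext ?_
    rw [← algebraMap_eq, AlgEquiv.commutes, Subalgebra.coe_algebraMap, algebraMap_eq,
      ← one_sub_pow_mul_hlR_zero, C_mul']
    rfl
  have h1 : tPoch t (k + 1) • p =
      (1 - t) ^ (k + 1) • (p * hlRe (k + 1) t fun _ => 0) := by
    rw [← mul_smul_comm, h0, mul_comm, C_mul']
  have h2 : p = (tPoch t (k + 1))⁻¹ • (1 - t) ^ (k + 1) • (p * hlRe (k + 1) t fun _ => 0) := by
    rw [← h1, smul_smul, inv_mul_cancel₀ (tPoch_ne_zero ht _), one_smul]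
  rw [h2]
  refine Submodule.smul_mem _ _ (Submodule.smul_mem _ _ ?_)
  rw [mul_hlRe_zero]
  refine sum_mem fun m hm => Submodule.smul_mem _ _ ?_
  refine Submodule.span_mono ?_ (hlRe_mem_hlSpan t m)
  rintro _ ⟨lam, hl, hs, rfl⟩
  refine ⟨lam, hl, ?_, rfl⟩
  rw [hs]
  have := le_totalDegree hm
  rw [Finsupp.sum_fintype _ _ (fun _ => rfl)] at this
  exact this.trans (totalDegree_esymmAlgEquiv_le hp)

end

/-! ### Freeness over the relations, and the basis of the quotient. -/

section

variable {K : Type*} [Field K]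

/-- The products of `R_λ` with monomials in the deformed relations. -/
def hlProd (n k : ℕ) (t : K) (x : (Fin k → ℕ) × (Fin k → ℕ)) : MvPolynomial (Fin k) K :=
  hlRe k t x.1 * ∏ i : Fin k, gTilde n k t i ^ x.2 i

lemma hlProd_mul_gTilde (n k : ℕ) (t : K) (lam α : Fin k → ℕ) (i : Fin k) :
    hlProd n k t (lam, α) * gTilde n k t i = hlProd n k t (lam, α + Pi.single i 1) := by
  simp only [hlProd, Pi.add_apply, pow_add, Finset.prod_mul_distrib, mul_assoc]
  congr 2
  rw [Finset.prod_eq_single i (fun j _ hj => by simp [hj]) (by simp)]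
  simp

/-- The span of the products of total weight at most `d`. -/
def hlProdSpan (n k : ℕ) (t : K) (d : ℕ) : Submodule K (MvPolynomial (Fin k) K) :=
  Submodule.span K (hlProd n k t '' pairLE k n (fun i => n + (i : ℕ)) d)

lemma pairLE_mono (k n : ℕ) (w : Fin k → ℕ) : Monotone (pairLE k n w) :=
  fun _ _ h _ hx => ⟨hx.1, hx.2.trans h⟩

lemma hlProdSpan_mono (n k : ℕ) (t : K) : Monotone (hlProdSpan n k t) := fun _ _ h =>
  Submodule.span_mono (Set.image_mono (pairLE_mono k n _ h))

lemma mul_gTilde_mem_hlProdSpan {n k : ℕ} {t : K} {d : ℕ} {p : MvPolynomial (Fin k) K}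
    (hp : p ∈ hlProdSpan n k t d) (i : Fin k) :
    p * gTilde n k t i ∈ hlProdSpan n k t (d + (n + i)) := by
  induction hp using Submodule.span_induction with
  | mem p hp =>
    obtain ⟨⟨lam, α⟩, hx, rfl⟩ := hp
    rw [hlProd_mul_gTilde]
    refine Submodule.subset_span ⟨(lam, α + Pi.single i 1), ⟨hx.1, ?_⟩, rfl⟩
    have := hx.2
    simp only [Pi.add_apply, mul_add, Finset.sum_add_distrib, Pi.single_apply, mul_ite, mul_one,
      mul_zero, Finset.sum_ite_eq', Finset.mem_univ, if_true] at this ⊢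
    omega
  | zero => rw [zero_mul]; exact zero_mem _
  | add p q _ _ hp hq => rw [add_mul]; exact add_mem hp hq
  | smul c p _ hp => rw [smul_mul_assoc]; exact Submodule.smul_mem _ _ hp

lemma gTilde_sub_gPoly_mem_weightFil {n k : ℕ} (hn : 1 ≤ n) (t : K) (r : ℕ) :
    gTilde n k t r - gPoly k t (n + r) ∈ weightFil K k (n + r - 1) := by
  rw [gTilde]
  split_ifs with h
  · subst h
    rw [add_zero, sub_sub_cancel_left]
    exact neg_mem (C_mem_weightFil _ _)
  · rw [add_sub_cancel_left]
    exact weightFil_mono k (by omega) (smul_C_mul_mem _ (gPoly_mem_weightFil k t⁻¹ r))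

/-- Outside the box, `R_λ` is a sum of terms `g_{n+i} b`. Passing to the deformed relation costs an
error of weight below `d`, and `b` also has weight below `d` since `n ≥ 1`; induction handles both.
-/
lemma weightFil_le_hlProdSpan {n k : ℕ} (hn : 1 ≤ n) {t : K} (ht : ∀ m, 0 < m → t ^ m ≠ 1)
    (d : ℕ) : weightFil K (k + 1) d ≤ hlProdSpan n (k + 1) t d := by
  have ht1 : t ≠ 1 := by simpa using ht 1 one_pos
  induction d using Nat.strong_induction_on with
  | _ d ih =>
    intro p hp
    refine Submodule.span_le.2 ?_ (mem_span_hlRe_of_mem_weightFil ht hp)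
    rintro _ ⟨lam, hlam, hd, rfl⟩
    by_cases hbox : lam 0 < n
    · refine Submodule.subset_span ⟨(lam, 0), ⟨⟨hlam, fun i => ?_⟩, by simpa using hd⟩, by
        simp [hlProd]⟩
      exact (hlam (Fin.zero_le i)).trans_lt hbox
    · refine Submodule.span_le.2 ?_ (gIdealFil_mono _ _ _ hd
        (hlRe_mem_gIdealFil ht1 hn lam (not_lt.1 hbox)))
      rintro _ ⟨i, hi, e, b, hb, he, rfl⟩
      have h1 := hlProdSpan_mono n (k + 1) t (show e + (n + i) ≤ d by omega)
        (mul_gTilde_mem_hlProdSpan (ih e (by omega) hb) ⟨i, hi⟩)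
      have h2 := hlProdSpan_mono n (k + 1) t (Nat.sub_le d 1) (ih (d - 1) (by omega)
        (weightFil_mono _ (by omega)
          (mul_mem_weightFil (gTilde_sub_gPoly_mem_weightFil (k := k + 1) hn t i) hb)))
      have h3 : gPoly (k + 1) t (n + i) * b = b * gTilde n (k + 1) t i -
        (gTilde n (k + 1) t i - gPoly (k + 1) t (n + i)) * b := by ring
      rw [h3]
      exact sub_mem h1 h2

lemma finrank_weightFil (k d : ℕ) : Module.finrank K (weightFil K k d) =
    (weightLE (fun i : Fin k => (i : ℕ) + 1) d).ncard := by
  rw [weightFil, Module.finrank_eq_nat_card_basis (basisRestrictSupport K _), ← Nat.card_coe_set_eq]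
  exact Nat.card_congr (Finsupp.equivFunOnFinite.subtypeEquiv fun _ => Iff.rfl)

/-- At each level `d` the number of products equals the dimension of a space inside their span. The
levels form a directed union. -/
lemma linearIndepOn_hlProd {n k : ℕ} (hn : 1 ≤ n) {t : K} (ht : ∀ m, 0 < m → t ^ m ≠ 1) :
    LinearIndepOn K (hlProd n (k + 1) t) {x | x.1 ∈ redAlcove (k + 1) n} := by
  have hU : {x : (Fin (k + 1) → ℕ) × (Fin (k + 1) → ℕ) | x.1 ∈ redAlcove (k + 1) n} =
      ⋃ d, pairLE (k + 1) n (fun i => n + (i : ℕ)) d := by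
    ext x
    simp only [Set.mem_iUnion]
    exact ⟨fun h => ⟨_, h, le_rfl⟩, fun ⟨_, h⟩ => h.1⟩
  rw [hU]
  refine linearIndepOn_iUnion_of_directed (pairLE_mono _ _ _).directed_le fun d => ?_
  have hfin := pairLE_finite (k + 1) n (w := fun i => n + (i : ℕ)) (fun i => by omega) d
  have := hfin.fintype
  rw [LinearIndepOn, linearIndependent_iff_card_le_finrank_span, ← Nat.card_eq_fintype_card,
    Nat.card_coe_set_eq, ncard_pairLE_eq _ _ hn, ← finrank_weightFil (K := K), Set.finrank,
    ← Set.image_eq_range]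
  have : FiniteDimensional K (Submodule.span K
      (hlProd n (k + 1) t '' pairLE (k + 1) n (fun i => n + (i : ℕ)) d)) :=
    FiniteDimensional.span_of_finite K (hfin.image _)
  exact Submodule.finrank_mono (weightFil_le_hlProdSpan hn ht d)

lemma gTilde_mem_betheIdeal (n k : ℕ) (t : K) (i : Fin k) : gTilde n k t i ∈ betheIdeal n k t :=
  Ideal.subset_span ⟨i, i.2, rfl⟩

/-- The span of the products of positive degree in the relations. -/
def hlProdPosSpan (n k : ℕ) (t : K) : Submodule K (MvPolynomial (Fin k) K) :=
  Submodule.span K (hlProd n k t '' {x | x.1 ∈ redAlcove k n ∧ x.2 ≠ 0})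

lemma mul_gTilde_mem_hlProdPosSpan {n k : ℕ} {t : K} {d : ℕ} {a : MvPolynomial (Fin k) K}
    (ha : a ∈ hlProdSpan n k t d) (i : Fin k) : a * gTilde n k t i ∈ hlProdPosSpan n k t := by
  induction ha using Submodule.span_induction with
  | mem a ha =>
    obtain ⟨⟨lam, α⟩, hx, rfl⟩ := ha
    rw [hlProd_mul_gTilde]
    refine Submodule.subset_span (Set.mem_image_of_mem _ ⟨hx.1, fun h => ?_⟩)
    have := congrFun h i
    simp at this
  | zero => rw [zero_mul]; exact zero_mem _
  | add p q _ _ hp hq => rw [add_mul]; exact add_mem hp hq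
  | smul c p _ hp => rw [smul_mul_assoc]; exact Submodule.smul_mem _ _ hp

lemma mem_hlProdPosSpan_of_mem_betheIdeal {n k : ℕ} (hn : 1 ≤ n) {t : K}
    (ht : ∀ m, 0 < m → t ^ m ≠ 1) {p : MvPolynomial (Fin (k + 1)) K}
    (hp : p ∈ betheIdeal n (k + 1) t) : p ∈ hlProdPosSpan n (k + 1) t := by
  -- `hlProdPosSpan` is only known to be a `K`-subspace; quantifying over multiples lets the
  -- induction over the ideal go through.
  suffices ∀ a, a * p ∈ hlProdPosSpan n (k + 1) t by simpa using this 1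
  induction hp using Submodule.span_induction with
  | mem p hp =>
    obtain ⟨r, hr, rfl⟩ := hp
    intro a
    obtain ⟨d, hd⟩ := exists_mem_weightFil a
    exact mul_gTilde_mem_hlProdPosSpan (weightFil_le_hlProdSpan hn ht d hd) ⟨r, hr⟩
  | zero => intro a; rw [mul_zero]; exact zero_mem _
  | add p q _ _ hp hq => intro a; rw [mul_add]; exact add_mem (hp a) (hq a)
  | smul c p _ hp => intro a; rw [smul_eq_mul, ← mul_assoc]; exact hp _

lemma mk_hlProd_of_ne_zero {n k : ℕ} {t : K} {lam α : Fin k → ℕ} (hα : α ≠ 0) :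
    Ideal.Quotient.mk (betheIdeal n k t) (hlProd n k t (lam, α)) = 0 := by
  obtain ⟨i, hi⟩ := Function.ne_iff.1 hα
  rw [Ideal.Quotient.eq_zero_iff_mem]
  refine Ideal.mul_mem_left _ _ (Ideal.mem_of_dvd _
    (Finset.dvd_prod_of_mem _ (Finset.mem_univ i)) ?_)
  exact Ideal.pow_mem_of_mem _ (gTilde_mem_betheIdeal n k t i) _ (Nat.pos_of_ne_zero hi)

lemma hlProd_zero {n k : ℕ} (t : K) (lam : Fin k → ℕ) : hlProd n k t (lam, 0) = hlRe k t lam := by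
  simp [hlProd]

/-- The ideal lies in the span of the products with nonzero exponent vector, which meets the span of
the bare `R_λ` only in `0` by independence of the whole family. -/
lemma linearIndependent_mk_hlRe {n k : ℕ} (hn : 1 ≤ n) {t : K} (ht : ∀ m, 0 < m → t ^ m ≠ 1) :
    LinearIndependent K fun lam : redAlcove (k + 1) n =>
      Ideal.Quotient.mk (betheIdeal n (k + 1) t) (hlRe (k + 1) t lam) := by
  have hli := linearIndepOn_hlProd (k := k) hn ht
  have hv : LinearIndependent K fun lam : redAlcove (k + 1) n => hlRe (k + 1) t lam := by
    have := hli.comp (fun lam : redAlcove (k + 1) n => ⟨(lam.1, 0), lam.2⟩)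
      (fun a b h => Subtype.ext (congrArg (fun x => x.1.1) h))
    simpa only [Function.comp_def, hlProd_zero] using this
  refine hv.map (f := (Ideal.Quotient.mkₐ K (betheIdeal n (k + 1) t)).toLinearMap) ?_
  have hdis := hli.disjoint_span_image (s := {x | x.1.2 = 0}) (t := {x | x.1.2 ≠ 0})
    (Set.disjoint_left.2 fun _ h h' => h' h)
  refine hdis.mono (Submodule.span_mono ?_) fun p hp => ?_
  · rintro _ ⟨lam, rfl⟩
    exact ⟨⟨(lam.1, 0), lam.2⟩, rfl, hlProd_zero t _⟩
  · have hp : p ∈ betheIdeal n (k + 1) t := Ideal.Quotient.eq_zero_iff_mem.1 hp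
    refine Submodule.span_mono ?_ (mem_hlProdPosSpan_of_mem_betheIdeal hn ht hp)
    rintro _ ⟨x, hx, rfl⟩
    exact ⟨⟨x, hx.1⟩, hx.2, rfl⟩

lemma span_mk_hlRe {n k : ℕ} (hn : 1 ≤ n) {t : K} (ht : ∀ m, 0 < m → t ^ m ≠ 1) :
    ⊤ ≤ Submodule.span K (Set.range fun lam : redAlcove (k + 1) n =>
      Ideal.Quotient.mk (betheIdeal n (k + 1) t) (hlRe (k + 1) t lam)) := by
  rintro x -
  obtain ⟨p, rfl⟩ := Ideal.Quotient.mk_surjective x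
  obtain ⟨d, hd⟩ := exists_mem_weightFil p
  have hp := weightFil_le_hlProdSpan hn ht d hd
  clear hd
  induction hp using Submodule.span_induction with
  | mem p hp =>
    obtain ⟨⟨lam, α⟩, hx, rfl⟩ := hp
    by_cases hα : α = 0
    · subst hα
      rw [hlProd_zero]
      exact Submodule.subset_span ⟨⟨lam, hx.1⟩, rfl⟩
    · rw [mk_hlProd_of_ne_zero hα]
      exact zero_mem _
  | zero => rw [map_zero]; exact zero_mem _
  | add p q _ _ hp hq => rw [map_add]; exact add_mem hp hq
  | smul c p _ hp => exact Submodule.smul_mem _ c hp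

/-- The scalar `(1 - t)^k / ∏ᵢ (t)_{mᵢ(λ)}` relating `P_λ` to `R_λ`. -/
def hlScalar {k : ℕ} (t : K) (lam : Fin k → ℕ) : K :=
  (1 - t) ^ k / ∏ i ∈ Finset.range (Finset.univ.sup lam + 1), tPoch t (partMult lam i)

lemma hlScalar_ne_zero {k : ℕ} {t : K} (ht : ∀ m, 0 < m → t ^ m ≠ 1) (lam : Fin k → ℕ) :
    hlScalar t lam ≠ 0 := by
  have h1 : 1 - t ≠ 0 := sub_ne_zero.2 fun h => ht 1 one_pos (by rw [pow_one, ← h])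
  exact div_ne_zero (pow_ne_zero _ h1) (Finset.prod_ne_zero_iff.2 fun _ _ => tPoch_ne_zero ht _)

lemma hlPe_eq {k : ℕ} (t : K) (lam : Fin k → ℕ) : hlPe k t lam = hlScalar t lam • hlRe k t lam :=
  map_smul _ _ _

/-- The basis of Hall–Littlewood polynomials of the coordinate ring. -/
def hlBasis {n k : ℕ} (hn : 1 ≤ n) {t : K} (ht : ∀ m, 0 < m → t ^ m ≠ 1) :
    Module.Basis (redAlcove (k + 1) n) K (CoordRing n (k + 1) t) :=
  (Module.Basis.mk (linearIndependent_mk_hlRe hn ht) (span_mk_hlRe hn ht)).isUnitSMul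
    (w := fun lam => hlScalar t lam.1) fun lam => (hlScalar_ne_zero ht lam.1).isUnit

lemma hlBasis_apply {n k : ℕ} (hn : 1 ≤ n) {t : K} (ht : ∀ m, 0 < m → t ^ m ≠ 1)
    (lam : redAlcove (k + 1) n) :
    hlBasis hn ht lam = Ideal.Quotient.mk (betheIdeal n (k + 1) t) (hlPe (k + 1) t lam) := by
  rw [hlBasis, Module.Basis.isUnitSMul_apply, Module.Basis.mk_apply, hlPe_eq]
  rfl

end

/-! ### Specialisation to Puiseux series. -/

lemma puiseuxT_pow_ne_one {m : ℕ} (hm : 0 < m) : puiseuxT ^ m ≠ 1 := by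
  intro h
  have h1 := congrArg (fun x : PuiseuxField => (x : HahnSeries ℚ ℂ).coeff 0) h
  simp only [puiseuxT, SubmonoidClass.coe_pow, HahnSeries.single_pow, OneMemClass.coe_one,
    HahnSeries.coeff_one, if_true] at h1
  rw [HahnSeries.coeff_single_of_ne (by simpa [eq_comm] using hm.ne')] at h1
  exact zero_ne_one h1
end

theorem mainTheorem9 (n k : ℕ) (hn : 1 ≤ n) (hk : 1 ≤ k) :
    Module.Finite PuiseuxField (CoordRing n k puiseuxT) ∧
    Module.finrank PuiseuxField (CoordRing n k puiseuxT) = (alcove k n).ncard ∧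
    (alcove k n).ncard = (n + k - 1).choose k ∧
    ∃ b : Module.Basis (redAlcove k n) PuiseuxField (CoordRing n k puiseuxT),
      ∀ lam : redAlcove k n,
        b lam = Ideal.Quotient.mk (betheIdeal n k puiseuxT) (hlPe k puiseuxT lam) := by
  obtain ⟨k, rfl⟩ := Nat.exists_eq_add_of_le' hk
  have ht : ∀ m, 0 < m → puiseuxT ^ m ≠ 1 := fun m => puiseuxT_pow_ne_one
  have : Finite (redAlcove (k + 1) n) := redAlcove_finite _ _
  refine ⟨Module.Finite.of_basis (hlBasis hn ht), ?_, ?_, hlBasis hn ht, hlBasis_apply hn ht⟩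
  · rw [Module.finrank_eq_nat_card_basis (hlBasis hn ht), ncard_alcove, Nat.card_coe_set_eq]
  · rw [ncard_alcove, ncard_redAlcove _ _ (by omega)]
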